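/- Let $\{e_t : t\in\mathbb Z\}$ be i.i.d. real random variables and let $\{y_t:t\in\mathbb Z\}$ be a strictly stationary process that satisfies, for all $t$, the AR($p$) equation (no change point, hypothesis $H_0$) $$y_t = X_{t-1}'\beta_0+e_t,\qquad X_{t-1}=(y_{t-1},\dots,y_{t-p})',\quad \beta_0\in\mathbb R^p .$$ Let $w:\mathbb R^p\to(0,\infty)$ and $\varphi:\mathbb R^p\to\mathbb R^q$ be measurable, $a(x)=(x',\varphi(x)')'\in\mathbb R^{m}$ with $m=p+q$, $a^*(x)=w(x)a(x)$, and $$g_t(\beta)=\bigl\{\tfrac12-\mathbb I(y_t-X_{t-1}'\beta\le 0)\bigr\}\,a^*(X_{t-1}).$$ Assume: 1. (i) $\mathcal B\subset\mathbb R^p$ is compact and $\beta_0\in\mathrm{Int}(\mathcal B)$; (ii) $1-\beta_1z-\dots-\beta_pz^p\ne0$ for all complex $|z|\le 1$ and all $\beta\in\mathcal B$; (iii) $0$ is a median of $e_t$; (iv) the distribution function $F$ of $e_t$ is differentiable (hence continuous) at $0$ with $F'(0)>0$. 2. $\mathbb E[(w(X_{t-1})+w(X_{t-1})^2)(\|a(X_{t-1})\|^2+\|a(X_{t-1})\|^3)]<\infty$.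 3. The matrix $\mathbb E[g_t(\beta_0)g_t(\beta_0)']$ is positive definite. 4. For some $\gamma>2$: (i) $\mathbb E\|a^*(X_{t-1})\|^\gamma<\infty$; (ii) the sequence $v_t=\mathrm{sign}(e_t)\,a^*(X_{t-1})$, $t\in\mathbb Z$, is strong mixing with mixing coefficients $\alpha_l$ satisfying $\sum_{l\ge1}\alpha_l^{1-2/\gamma}<\infty$. For $1\le k\le n-1$ let $$L_{n,k}(\theta_1,\theta_2)=\sup\Bigl\{\prod_{i=1}^n v_i:\ v\in[0,1]^n,\ \sum_{i=1}^k v_i=\sum_{j=k+1}^n v_j=1,\ \sum_{i=1}^k v_ig_i(\theta_1)=\sum_{j=k+1}^n v_jg_j(\theta_2)=0\Bigr\}$$ ($\sup\emptyset=0$), let $L_{n,k,E}$ be the same supremum without the last two constraints, and let $l_{n,k}(\theta_1,\theta_2)=-\log\{L_{n,k}(\theta_1,\theta_2)/L_{n,k,E}\}\in[0,\infty]$. Fix $r\in(0,1)$, put $k^*=\lfloor rn\rfloor$, and let $\hat\beta_{n,k^*}\in\mathcal B$ be any maximum empirical likelihood estimator, that is, almost surely $$-l_{n,k^*}(\hat\beta_{n,k^*},\hat\beta_{n,k^*})=\sup_{\beta\in\mathcal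 B}\{-l_{n,k^*}(\beta,\beta)\}$$ (for the finitely many $n$ with $k^*=0$, any element of $\mathcal B$ is admitted). Then, as $n\to\infty$, $$\hat\beta_{n,k^*}-\beta_0=O_p(n^{-1/2}),$$ that is, for every $\varepsilon>0$ there is $C>0$ with $P(\|\hat\beta_{n,k^*}-\beta_0\|>Cn^{-1/2})\le\varepsilon$ for all large $n$ (outer probability, if $\hat\beta_{n,k^*}$ is not measurable). No moment assumption on $e_t$ beyond the above is made. -/

import Mathlib

open MeasureTheory ProbabilityTheory Filter Topology
open scoped ENNReal

noncomputable section

namespace ARChange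

/-- The vector of the last `p` values up to time `t`: `X_t = (y_t, …, y_{t-p+1})'`. -/
def lagVec (p : ℕ) (y : ℤ → ℝ) (t : ℤ) : EuclideanSpace ℝ (Fin p) :=
  WithLp.toLp 2 fun i => y (t - (i : ℤ))

/-- `a(x) = (x', φ(x)')'`, a vector of dimension `m = p + q`. -/
def aFun {p q : ℕ} (φ : EuclideanSpace ℝ (Fin p) → EuclideanSpace ℝ (Fin q))
    (x : EuclideanSpace ℝ (Fin p)) : EuclideanSpace ℝ (Fin p ⊕ Fin q) :=
  WithLp.toLp 2 (Sum.elim (fun i => x i) (fun j => φ x j))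

/-- The self-weighted function `a*(x) = w(x) a(x)`. -/
def aStar {p q : ℕ} (w : EuclideanSpace ℝ (Fin p) → ℝ)
    (φ : EuclideanSpace ℝ (Fin p) → EuclideanSpace ℝ (Fin q))
    (x : EuclideanSpace ℝ (Fin p)) : EuclideanSpace ℝ (Fin p ⊕ Fin q) :=
  w x • aFun φ x

open Classical in
/-- The self-weighted median moment function
`{1/2 - 𝕀(y_t - X_{t-1}'β ≤ 0)} a*(X_{t-1})` of a path `y` at time `t`. -/
def gFun {p q : ℕ} (w : EuclideanSpace ℝ (Fin p) → ℝ)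
    (φ : EuclideanSpace ℝ (Fin p) → EuclideanSpace ℝ (Fin q))
    (y : ℤ → ℝ) (t : ℤ) (β : EuclideanSpace ℝ (Fin p)) :
    EuclideanSpace ℝ (Fin p ⊕ Fin q) :=
  ((1 / 2 : ℝ) - if y t - inner ℝ (lagVec p y (t - 1)) β ≤ 0 then 1 else 0) •
    aStar w φ (lagVec p y (t - 1))

/-- Weights `(v_1, …, v_n) ∈ [0,1]^n` with `∑_{i ≤ k} v_i = ∑_{k < j ≤ n} v_j = 1`.
A weight vector is a function on `ℕ` of which only the coordinates `1, …, n` are used. -/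
def weightSet (n k : ℕ) : Set (ℕ → ℝ) :=
  {v | (∀ i ∈ Finset.Icc 1 n, v i ∈ Set.Icc (0 : ℝ) 1) ∧
    ∑ i ∈ Finset.Icc 1 k, v i = 1 ∧ ∑ j ∈ Finset.Icc (k + 1) n, v j = 1}

/-- Weights that satisfy both weighted moment constraints, for the moment functions
`g 1, …, g n`. -/
def momentSet {Θ M : Type*} [AddCommGroup M] [Module ℝ M] (g : ℕ → Θ → M)
    (n k : ℕ) (θ₁ θ₂ : Θ) : Set (ℕ → ℝ) :=
  {v | ∑ i ∈ Finset.Icc 1 k, v i • g i θ₁ = 0 ∧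
    ∑ j ∈ Finset.Icc (k + 1) n, v j • g j θ₂ = 0}

/-- The objective `(∏_{i ≤ k} v_i) (∏_{k < j ≤ n} v_j)`. -/
def weightProd (n k : ℕ) (v : ℕ → ℝ) : ℝ≥0∞ :=
  ENNReal.ofReal ((∏ i ∈ Finset.Icc 1 k, v i) * ∏ j ∈ Finset.Icc (k + 1) n, v j)

/-- The empirical likelihood `L_{n,k}(θ₁, θ₂)`; it is `0` if no weights are feasible. -/
def empLik {Θ M : Type*} [AddCommGroup M] [Module ℝ M] (g : ℕ → Θ → M)
    (n k : ℕ) (θ₁ θ₂ : Θ) : ℝ≥0∞ :=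
  ⨆ v ∈ weightSet n k ∩ momentSet g n k θ₁ θ₂, weightProd n k v

/-- The unconstrained maximum `L_{n,k,E}` of the empirical likelihood. -/
def empLikMax (n k : ℕ) : ℝ≥0∞ :=
  ⨆ v ∈ weightSet n k, weightProd n k v

/-- The log empirical likelihood ratio `l_{n,k}(θ₁, θ₂) = -log (L_{n,k}(θ₁, θ₂) / L_{n,k,E})`,
with values in the extended reals (`-log 0 = ∞`). -/
def logELR {Θ M : Type*} [AddCommGroup M] [Module ℝ M] (g : ℕ → Θ → M)
    (n k : ℕ) (θ₁ θ₂ : Θ) : EReal :=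
  -ENNReal.log (empLik g n k θ₁ θ₂ / empLikMax n k)

/-- `b` is a maximum empirical likelihood estimator over the parameter space `B`:
`b ∈ B` and `-l_{n,k}(b, b) = sup_{β ∈ B} {-l_{n,k}(β, β)}`. -/
def IsMaxEL {Θ M : Type*} [AddCommGroup M] [Module ℝ M] (B : Set Θ) (g : ℕ → Θ → M)
    (n k : ℕ) (b : Θ) : Prop :=
  b ∈ B ∧ -logELR g n k b b = ⨆ β ∈ B, -logELR g n k β β

/-- The process `y` is strictly stationary. -/
def IsStrictlyStationary {Ω : Type*} [MeasurableSpace Ω] (P : Measure Ω)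
    (y : ℤ → Ω → ℝ) : Prop :=
  ∀ h : ℤ, P.map (fun ω t => y (t + h) ω) = P.map (fun ω t => y t ω)

/-- The strong (`α`-) mixing coefficient of `v` at lag `l`:
the supremum of `|P(A ∩ B) - P(A) P(B)|` over all times `t`, all `A ∈ σ(v_s : s ≤ t)` and
all `B ∈ σ(v_s : s ≥ t + l)`. -/
def alphaMixing {Ω E : Type*} [MeasurableSpace Ω] [mE : MeasurableSpace E] (P : Measure Ω)
    (v : ℤ → Ω → E) (l : ℕ) : ℝ :=
  sSup {c : ℝ | ∃ (t : ℤ) (A B : Set Ω),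
    MeasurableSet[⨆ s : {s : ℤ // s ≤ t}, mE.comap (v s)] A ∧
    MeasurableSet[⨆ s : {s : ℤ // t + l ≤ s}, mE.comap (v s)] B ∧
    c = |P.real (A ∩ B) - P.real A * P.real B|}

/-- The process `v` is strong mixing. -/
def IsStrongMixing {Ω E : Type*} [MeasurableSpace Ω] [MeasurableSpace E] (P : Measure Ω)
    (v : ℤ → Ω → E) : Prop :=
  Tendsto (fun l => alphaMixing P v l) atTop (𝓝 0)

/-- `Z_n = O_p(r_n)`: for every `ε > 0` there is `C` such that `P(‖Z_n‖ > C r_n) ≤ ε` for all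
large `n`. For a set that is not measurable, `P` is the outer probability. -/
def IsBigOInProb {Ω E : Type*} [MeasurableSpace Ω] [Norm E] (P : Measure Ω)
    (Z : ℕ → Ω → E) (r : ℕ → ℝ) : Prop :=
  ∀ ε : ℝ, 0 < ε → ∃ C : ℝ, 0 < C ∧
    ∀ᶠ n in atTop, P {ω | C * r n < ‖Z n ω‖} ≤ ENNReal.ofReal ε

end ARChange

end

/-!
The empirical likelihood at `β` is compared with that at `β₀` from both sides.

At `β₀` the moment functions are, up to a null set, `sign (e t) / 2` times the weighted regressors.
The regression is causal (`indepFun_past`), so they are martingale differences, and their sum over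
each of the two segments is of order `√n` (`IsCausalRegression.measureReal_norm_sum_ge_le`). Their
second moment matrix stays nondegenerate (`exists_quadratic_lower_bound`) and their maximum is of
smaller order than `√n`. Explicit feasible weights, the linearization of the optimal ones, then show
that the log likelihood ratio at `β₀` is bounded in probability (`exists_weights`).

Away from `β₀`, feasible weights against any multiplier `μ` with small `⟪μ, g i⟫` bound the
likelihood ratio by `exp (-∑ ⟪μ, g i⟫ + 2 ∑ ⟪μ, g i⟫ ^ 2)` (`prod_weights_le`); only the first
segment and the multiplier `μ = -u / √n` are needed, where `u` is the direction of `β - β₀`. The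
component of the moment function along `u` is monotone in the distance from `β₀`, being the
derivative of a weighted absolute deviation. Hence it suffices to see how far the sum has moved
once the distance is `C / √n`; parameters far from `β₀` need no argument of their own. The move
consists of nonnegative terms `stepGain`, which are bounded below by
counting errors in an interval of length proportional to `C / √n` next to their median
(`exists_sum_stepGain_lower_bound`). It is of order `C * √n`, which for large `C` beats every other
term, so that outside the ball of radius `C / √n` the likelihood is smaller than at `β₀`
(`empLik_lt`).

The law of large numbers is needed only for the number of visits of the mixing process
`sign (e t) • a* (X (t - 1))` to sets in the space of the moment functions
(`tendsto_measureReal_count_le`).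
-/

namespace ARChange

/-! ### Deterministic bounds for the empirical likelihood -/

lemma exp_sub_two_mul_sq_le {x : ℝ} (hx : |x| ≤ 1 / 5) :
    Real.exp (x - 2 * x ^ 2) ≤ 1 + x := by
  obtain ⟨h1, h2⟩ := abs_le.1 hx
  have hy : |x - 2 * x ^ 2| ≤ 1 := abs_le.2 ⟨by nlinarith, by nlinarith⟩
  have h := (abs_le.1 (Real.abs_exp_sub_one_sub_id_le hy)).2
  have h3 : (1 - 2 * x) ^ 2 ≤ 2 := by nlinarith
  nlinarith [mul_le_mul_of_nonneg_left h3 (sq_nonneg x)]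

/-- The product of the weights against the factors `1 + x i` is bounded by the inequality between
the arithmetic and the geometric mean. For `x i = ⟪μ, g i⟫` this is the weak duality of empirical
likelihood with multiplier `μ`. -/
lemma prod_weights_le {ι : Type*} {s : Finset ι} (hs : s.Nonempty) {v x : ι → ℝ}
    (hv : ∀ i ∈ s, 0 ≤ v i) (hsum : ∑ i ∈ s, v i = 1) (hx : ∀ i ∈ s, |x i| ≤ 1 / 5)
    (hvx : ∑ i ∈ s, v i * x i = 0) :
    ∏ i ∈ s, v i ≤ (1 / (s.card : ℝ)) ^ s.card *
      Real.exp (-(∑ i ∈ s, x i - 2 * ∑ i ∈ s, x i ^ 2)) := by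
  have hN : (0 : ℝ) < s.card := by exact_mod_cast hs.card_pos
  have hz : ∀ i ∈ s, 0 ≤ v i * (1 + x i) := fun i hi =>
    mul_nonneg (hv i hi) (by linarith [(abs_le.1 (hx i hi)).1])
  have h1 : ∏ i ∈ s, v i * (1 + x i) ≤ (1 / (s.card : ℝ)) ^ s.card := by
    have h := Real.geom_mean_le_arith_mean s (fun _ => 1) (fun i => v i * (1 + x i))
      (fun _ _ => zero_le_one) (by simpa using hN) hz
    simp only [Real.rpow_one, Finset.sum_const, nsmul_eq_mul, mul_one, one_mul] at h
    have hs1 : ∑ i ∈ s, v i * (1 + x i) = 1 := by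
      simp only [mul_add, mul_one, Finset.sum_add_distrib, hsum, hvx, add_zero]
    rw [hs1] at h
    calc ∏ i ∈ s, v i * (1 + x i)
        = ((∏ i ∈ s, v i * (1 + x i)) ^ ((s.card : ℝ)⁻¹)) ^ s.card := by
          rw [← Real.rpow_natCast, ← Real.rpow_mul (Finset.prod_nonneg hz),
            inv_mul_cancel₀ hN.ne', Real.rpow_one]
      _ ≤ _ := pow_le_pow_left₀ (Real.rpow_nonneg (Finset.prod_nonneg hz) _) h _
  have h2 : (∏ i ∈ s, v i) * Real.exp (∑ i ∈ s, x i - 2 * ∑ i ∈ s, x i ^ 2)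
      ≤ ∏ i ∈ s, v i * (1 + x i) := by
    rw [Finset.prod_mul_distrib, Finset.mul_sum, ← Finset.sum_sub_distrib, Real.exp_sum]
    exact mul_le_mul_of_nonneg_left
      (Finset.prod_le_prod (fun _ _ => (Real.exp_pos _).le)
        (fun i hi => exp_sub_two_mul_sq_le (hx i hi))) (Finset.prod_nonneg hv)
  rw [Real.exp_neg, ← div_eq_mul_inv, le_div_iff₀ (Real.exp_pos _)]
  exact h2.trans h1

/-- Explicit feasible weights with a large product: `v i = (1 - ⟪μ, g i - ḡ⟫) / N`, where `μ`
solves the linear system `S μ = ḡ` for the sample covariance `S` and the sample mean `ḡ`. -/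
lemma exists_weights {ι E : Type*} [NormedAddCommGroup E] [InnerProductSpace ℝ E]
    [FiniteDimensional ℝ E] {s : Finset ι} (hs : s.Nonempty) (g : ι → E) {c L D : ℝ} (hc : 0 < c)
    (hg2 : ∀ u : E, 2 * c * s.card * ‖u‖ ^ 2 ≤ ∑ i ∈ s, inner ℝ u (g i) ^ 2)
    (hgD : ∀ i ∈ s, ‖g i‖ ≤ D)
    (hsumg : ‖∑ i ∈ s, g i‖ ≤ L) (hL : L ^ 2 ≤ c * s.card ^ 2)
    (hLD : 10 * (L * D) ≤ c * s.card) :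
    ∃ v : ι → ℝ, (∀ i ∈ s, v i ∈ Set.Icc (0 : ℝ) 1) ∧ ∑ i ∈ s, v i = 1 ∧
      ∑ i ∈ s, v i • g i = 0 ∧
      (1 / (s.card : ℝ)) ^ s.card * Real.exp (-(2 * L ^ 2 / (c * s.card))) ≤ ∏ i ∈ s, v i := by
  classical
  have hN : (0 : ℝ) < s.card := by exact_mod_cast hs.card_pos
  obtain ⟨N, hNs⟩ : ∃ N : ℝ, N = s.card := ⟨_, rfl⟩
  simp only [← hNs] at hg2 hL hLD hN ⊢
  set m : E := N⁻¹ • ∑ i ∈ s, g i with hm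
  have hL0 : 0 ≤ L := (norm_nonneg _).trans hsumg
  have hmN : ∑ i ∈ s, g i = N • m := by rw [hm, smul_smul, mul_inv_cancel₀ hN.ne', one_smul]
  have hmL : N * ‖m‖ ≤ L := by
    rw [hmN, norm_smul, Real.norm_of_nonneg hN.le] at hsumg; exact hsumg
  have hcen : ∑ i ∈ s, (g i - m) = 0 := by
    rw [Finset.sum_sub_distrib, hmN, Finset.sum_const, ← Nat.cast_smul_eq_nsmul ℝ, ← hNs, sub_self]
  -- the sample covariance operator, multiplied by `N`
  let S : E →ₗ[ℝ] E :=
    { toFun := fun u => ∑ i ∈ s, (inner ℝ u (g i - m) : ℝ) • (g i - m)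
      map_add' := fun u u' => by simp [inner_add_left, add_smul, Finset.sum_add_distrib]
      map_smul' := fun r u => by simp [inner_smul_left, mul_smul, Finset.smul_sum] }
  have hS : ∀ u, S u = ∑ i ∈ s, (inner ℝ u (g i - m) : ℝ) • (g i - m) := fun _ => rfl
  have hquad : ∀ u, inner ℝ u (S u) = ∑ i ∈ s, inner ℝ u (g i - m) ^ 2 := fun u => by
    rw [hS, inner_sum]
    exact Finset.sum_congr rfl fun i _ => by rw [inner_smul_right, sq]
  have hlow : ∀ u, c * N * ‖u‖ ^ 2 ≤ inner ℝ u (S u) := fun u => by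
    have h1 : ∑ i ∈ s, inner ℝ u (g i - m) ^ 2
        = ∑ i ∈ s, inner ℝ u (g i) ^ 2 - N * inner ℝ u m ^ 2 := by
      have : ∑ i ∈ s, (inner ℝ u (g i) : ℝ) = N * inner ℝ u m := by
        rw [← inner_sum, hmN, inner_smul_right]
      calc ∑ i ∈ s, inner ℝ u (g i - m) ^ 2
          = ∑ i ∈ s, (inner ℝ u (g i) ^ 2 - 2 * inner ℝ u m * inner ℝ u (g i)
              + inner ℝ u m ^ 2) :=
            Finset.sum_congr rfl fun i _ => by rw [inner_sub_right]; ring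
        _ = _ := by
            rw [Finset.sum_add_distrib, Finset.sum_sub_distrib, ← Finset.mul_sum, this,
              Finset.sum_const, nsmul_eq_mul, ← hNs]; ring
    have h2 : (inner ℝ u m : ℝ) ^ 2 ≤ ‖u‖ ^ 2 * ‖m‖ ^ 2 := by
      rw [← mul_pow]; exact sq_le_sq' (neg_le_of_abs_le (abs_real_inner_le_norm u m))
        (real_inner_le_norm u m)
    have h3 : N * ‖m‖ ^ 2 ≤ c * N := by
      have : (N * ‖m‖) ^ 2 ≤ c * N ^ 2 := (pow_le_pow_left₀ (by positivity) hmL 2).trans hL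
      have : N * (N * ‖m‖ ^ 2) ≤ N * (c * N) := by nlinarith
      exact le_of_mul_le_mul_left this hN
    rw [hquad, h1]
    nlinarith [hg2 u, mul_le_mul_of_nonneg_left h2 hN.le,
      mul_le_mul_of_nonneg_left h3 (sq_nonneg ‖u‖)]
  have hinj : Function.Injective S := by
    rw [← LinearMap.ker_eq_bot, LinearMap.ker_eq_bot']
    intro u hu
    have := hlow u
    rw [hu, inner_zero_right] at this
    have h0 : ‖u‖ ^ 2 ≤ 0 := by
      by_contra h; push Not at h
      have : 0 < c * N * ‖u‖ ^ 2 := by positivity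
      linarith
    exact norm_eq_zero.1 (pow_eq_zero_iff two_ne_zero |>.1 (le_antisymm h0 (sq_nonneg _)))
  obtain ⟨μ, hμ⟩ := LinearMap.injective_iff_surjective.1 hinj (N • m)
  have hμn : c * N * ‖μ‖ ≤ L := by
    have h1 := hlow μ
    rw [hμ, inner_smul_right] at h1
    have h2 := real_inner_le_norm μ m
    rcases (norm_nonneg μ).eq_or_lt with h0 | h0
    · rw [← h0]; simpa using hL0
    · have : ‖μ‖ * (c * N * ‖μ‖) ≤ ‖μ‖ * L := by nlinarith
      exact le_of_mul_le_mul_left this h0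
  set x : ι → ℝ := fun i => -inner ℝ μ (g i - m) with hx
  have hD0 : 0 ≤ D := by
    obtain ⟨i, hi⟩ := hs; exact (norm_nonneg _).trans (hgD i hi)
  have hmD : ‖m‖ ≤ D := by
    have h1 : ‖∑ i ∈ s, g i‖ ≤ N * D := by
      refine (norm_sum_le_of_le s hgD).trans ?_
      rw [Finset.sum_const, nsmul_eq_mul, ← hNs]
    rw [hmN, norm_smul, Real.norm_of_nonneg hN.le] at h1
    exact le_of_mul_le_mul_left h1 hN
  have hxb : ∀ i ∈ s, |x i| ≤ 1 / 5 := fun i hi => by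
    have h1 : |x i| ≤ ‖μ‖ * (2 * D) := by
      rw [hx]; simp only [abs_neg]
      refine (abs_real_inner_le_norm _ _).trans (mul_le_mul_of_nonneg_left ?_ (norm_nonneg _))
      linarith [norm_sub_le (g i) m, hgD i hi]
    have h2 : c * N * |x i| ≤ c * N * (1 / 5) := by
      nlinarith [mul_le_mul_of_nonneg_left h1 (by positivity : 0 ≤ c * N),
        mul_le_mul_of_nonneg_right hμn (by positivity : 0 ≤ 2 * D)]
    exact le_of_mul_le_mul_left h2 (by positivity)
  have hx0 : ∑ i ∈ s, x i = 0 := by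
    rw [hx, Finset.sum_neg_distrib, ← inner_sum, hcen, inner_zero_right, neg_zero]
  have hx2 : ∑ i ∈ s, x i ^ 2 ≤ L ^ 2 / (c * N) := by
    have : ∑ i ∈ s, x i ^ 2 = N * inner ℝ μ m := by
      rw [← inner_smul_right, ← hμ, hquad]
      exact Finset.sum_congr rfl fun i _ => by rw [hx]; ring
    rw [this, le_div_iff₀ (by positivity)]
    nlinarith [real_inner_le_norm μ m, mul_le_mul hμn hmL (by positivity) hL0,
      mul_le_mul_of_nonneg_left (real_inner_le_norm μ m) (by positivity : 0 ≤ c * N * N)]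
  have hv0 : ∀ i ∈ s, 0 ≤ N⁻¹ * (1 + x i) := fun i hi =>
    mul_nonneg (by positivity) (by linarith [(abs_le.1 (hxb i hi)).1])
  have hv1 : ∑ i ∈ s, N⁻¹ * (1 + x i) = 1 := by
    rw [← Finset.mul_sum, Finset.sum_add_distrib, hx0, Finset.sum_const, nsmul_eq_mul,
      ← hNs, mul_one,
      add_zero, inv_mul_cancel₀ hN.ne']
  refine ⟨fun i => N⁻¹ * (1 + x i), fun i hi => ⟨hv0 i hi, ?_⟩, hv1, ?_, ?_⟩
  · refine le_of_le_of_eq ?_ hv1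
    exact Finset.single_le_sum (f := fun i => N⁻¹ * (1 + x i)) hv0 hi
  · have h1 : ∑ i ∈ s, x i • g i = -(N • m) := by
      have h2 : ∑ i ∈ s, x i • (g i - m) = -(N • m) := by
        rw [← hμ, hS, ← Finset.sum_neg_distrib]
        exact Finset.sum_congr rfl fun i _ => by rw [hx, neg_smul]
      simp only [smul_sub, Finset.sum_sub_distrib, ← Finset.sum_smul, hx0, zero_smul,
        sub_zero] at h2
      exact h2
    simp only [mul_smul, add_smul, one_smul, ← Finset.smul_sum, Finset.sum_add_distrib, h1, hmN,
      add_neg_cancel, smul_zero]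
  · rw [Finset.prod_mul_distrib, Finset.prod_const, one_div]
    refine mul_le_mul_of_nonneg_left ?_ (by positivity)
    calc Real.exp (-(2 * L ^ 2 / (c * N))) ≤ Real.exp (∑ i ∈ s, (x i - 2 * x i ^ 2)) := by
          rw [Finset.sum_sub_distrib, hx0, ← Finset.mul_sum, Real.exp_le_exp, mul_div_assoc]
          linarith
      _ = ∏ i ∈ s, Real.exp (x i - 2 * x i ^ 2) := Real.exp_sum _ _
      _ ≤ _ := Finset.prod_le_prod (fun _ _ => (Real.exp_pos _).le)
          fun i hi => exp_sub_two_mul_sq_le (hxb i hi)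

lemma empLikMax_ne_top (n k : ℕ) (hk : k ≤ n) : empLikMax n k ≠ ⊤ := by
  refine ne_top_of_le_ne_top ENNReal.one_ne_top (iSup₂_le fun v hv => ?_)
  have h1 : ∀ i ∈ Finset.Icc 1 k, v i ∈ Set.Icc (0 : ℝ) 1 := fun i hi => hv.1 i
    (Finset.Icc_subset_Icc le_rfl hk hi)
  have h2 : ∀ i ∈ Finset.Icc (k + 1) n, v i ∈ Set.Icc (0 : ℝ) 1 := fun i hi => hv.1 i
    (Finset.Icc_subset_Icc (by omega) le_rfl hi)
  rw [weightProd, ENNReal.ofReal_le_one]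
  exact mul_le_one₀ (Finset.prod_le_one (fun i hi => (h1 i hi).1) fun i hi => (h1 i hi).2)
    (Finset.prod_nonneg fun i hi => (h2 i hi).1)
    (Finset.prod_le_one (fun i hi => (h2 i hi).1) fun i hi => (h2 i hi).2)

lemma empLik_le_empLikMax {Θ M : Type*} [AddCommGroup M] [Module ℝ M] (g : ℕ → Θ → M) (n k : ℕ)
    (θ₁ θ₂ : Θ) : empLik g n k θ₁ θ₂ ≤ empLikMax n k :=
  biSup_mono fun _ hv => hv.1

/-- A maximum empirical likelihood estimator maximizes the empirical likelihood. -/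
lemma IsMaxEL.empLik_le {Θ M : Type*} [AddCommGroup M] [Module ℝ M] {B : Set Θ} {g : ℕ → Θ → M}
    {n k : ℕ} {b θ : Θ} (hk : k ≤ n) (h : IsMaxEL B g n k b) (hθ : θ ∈ B) :
    empLik g n k θ θ ≤ empLik g n k b b := by
  rcases eq_or_ne (empLikMax n k) 0 with h0 | h0
  · exact ((empLik_le_empLikMax g n k θ θ).trans h0.le).trans (zero_le)
  have h1 : -logELR g n k θ θ ≤ -logELR g n k b b :=
    h.2 ▸ le_iSup₂ (f := fun β (_ : β ∈ B) => -logELR g n k β β) θ hθ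
  simp only [logELR, neg_neg, ENNReal.log_le_log_iff] at h1
  have ht := empLikMax_ne_top n k hk
  calc _ = empLik g n k θ θ / empLikMax n k * empLikMax n k := (ENNReal.div_mul_cancel h0 ht).symm
    _ ≤ empLik g n k b b / empLikMax n k * empLikMax n k := by gcongr
    _ = _ := ENNReal.div_mul_cancel h0 ht

/-- If the moment functions at `θ₀` are well behaved on both segments, while at `θ` their sum over
the first segment is large in the direction of `μ`, then `θ` has a smaller empirical likelihood
than `θ₀`. -/
lemma empLik_lt {Θ E : Type*} [NormedAddCommGroup E] [InnerProductSpace ℝ E]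
    [FiniteDimensional ℝ E] (g : ℕ → Θ → E) {n k : ℕ} (hk : 0 < k) (hkn : k < n) (θ₀ θ : Θ)
    {c L D N : ℝ} (hc : 0 < c) (hN0 : 0 < N) (hN1 : N ≤ k) (hN2 : N ≤ (n : ℝ) - k)
    (hg2₁ : ∀ u : E, 2 * c * k * ‖u‖ ^ 2 ≤ ∑ i ∈ Finset.Icc 1 k, inner ℝ u (g i θ₀) ^ 2)
    (hg2₂ : ∀ u : E, 2 * c * ((n : ℝ) - k) * ‖u‖ ^ 2 ≤
      ∑ i ∈ Finset.Icc (k + 1) n, inner ℝ u (g i θ₀) ^ 2)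
    (hgD : ∀ i ∈ Finset.Icc 1 n, ‖g i θ₀‖ ≤ D)
    (hsum₁ : ‖∑ i ∈ Finset.Icc 1 k, g i θ₀‖ ≤ L)
    (hsum₂ : ‖∑ i ∈ Finset.Icc (k + 1) n, g i θ₀‖ ≤ L)
    (hL : L ^ 2 ≤ c * N ^ 2) (hLD : 10 * (L * D) ≤ c * N)
    (μ : E) (hμ : ∀ i ∈ Finset.Icc 1 k, |inner ℝ μ (g i θ)| ≤ 1 / 5)
    (hlarge : 4 * L ^ 2 / (c * N) + 2 * ∑ i ∈ Finset.Icc 1 k, inner ℝ μ (g i θ) ^ 2 <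
      inner ℝ μ (∑ i ∈ Finset.Icc 1 k, g i θ)) :
    empLik g n k θ θ < empLik g n k θ₀ θ₀ := by
  have hc1 : (Finset.Icc 1 k).card = k := by simp
  have hc2 : (Finset.Icc (k + 1) n).card = n - k := by simp
  have hc2' : ((Finset.Icc (k + 1) n).card : ℝ) = (n : ℝ) - k := by
    rw [hc2, Nat.cast_sub hkn.le]
  have hs1 : (Finset.Icc 1 k).Nonempty := Finset.nonempty_Icc.2 hk
  have hs2 : (Finset.Icc (k + 1) n).Nonempty := Finset.nonempty_Icc.2 hkn
  have hsub1 : Finset.Icc 1 k ⊆ Finset.Icc 1 n := Finset.Icc_subset_Icc le_rfl hkn.le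
  have hsub2 : Finset.Icc (k + 1) n ⊆ Finset.Icc 1 n := Finset.Icc_subset_Icc (by omega) le_rfl
  set Q : ℝ := (1 / (k : ℝ)) ^ k * (1 / (((Finset.Icc (k + 1) n).card : ℕ) : ℝ)) ^
    (Finset.Icc (k + 1) n).card with hQ
  have hQ0 : 0 < Q := by
    have : 0 < (Finset.Icc (k + 1) n).card := hs2.card_pos
    positivity
  have hN2' : N ≤ (Finset.Icc (k + 1) n).card := hc2' ▸ hN2
  have hkpos : (0 : ℝ) < k := by exact_mod_cast hk
  obtain ⟨v, hv01, hv1, hvg, hvp⟩ := exists_weights hs1 (fun i => g i θ₀) (c := c) (L := L) (D := D)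
    hc (by simpa only [hc1] using hg2₁) (fun i hi => hgD i (hsub1 hi)) hsum₁
    (by rw [hc1]; exact hL.trans (by gcongr)) (by rw [hc1]; exact hLD.trans (by gcongr))
  obtain ⟨v', hv01', hv1', hvg', hvp'⟩ := exists_weights hs2 (fun i => g i θ₀) (c := c) (L := L)
    (D := D) hc (by simpa only [hc2'] using hg2₂) (fun i hi => hgD i (hsub2 hi)) hsum₂
    (hL.trans (by gcongr)) (hLD.trans (by gcongr))
  have hM : ∀ {K : ℝ}, N ≤ K → Real.exp (-(2 * L ^ 2 / (c * N))) ≤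
      Real.exp (-(2 * L ^ 2 / (c * K))) := fun {K} hK => by
    rw [Real.exp_le_exp, neg_le_neg_iff]; gcongr
  -- the lower bound at `θ₀`
  have hlow : ENNReal.ofReal (Q * Real.exp (-(4 * L ^ 2 / (c * N)))) ≤ empLik g n k θ₀ θ₀ := by
    classical
    let z : ℕ → ℝ := fun i => if i ≤ k then v i else v' i
    have hz1 : ∀ i ∈ Finset.Icc 1 k, z i = v i := fun i hi => if_pos (Finset.mem_Icc.1 hi).2
    have hz2 : ∀ i ∈ Finset.Icc (k + 1) n, z i = v' i := fun i hi =>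
      if_neg (by have := (Finset.mem_Icc.1 hi).1; omega)
    have hz : z ∈ weightSet n k ∩ momentSet g n k θ₀ θ₀ := by
      refine ⟨⟨fun i hi => ?_, ?_, ?_⟩, ?_, ?_⟩
      · have hi' := Finset.mem_Icc.1 hi
        by_cases h : i ≤ k
        · have : i ∈ Finset.Icc 1 k := Finset.mem_Icc.2 ⟨hi'.1, h⟩
          rw [hz1 i this]; exact hv01 i this
        · have : i ∈ Finset.Icc (k + 1) n := Finset.mem_Icc.2 ⟨by omega, hi'.2⟩
          rw [hz2 i this]; exact hv01' i this
      · rw [Finset.sum_congr rfl hz1, hv1]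
      · rw [Finset.sum_congr rfl hz2, hv1']
      · rw [← hvg]; exact Finset.sum_congr rfl fun i hi => by rw [hz1 i hi]
      · rw [← hvg']; exact Finset.sum_congr rfl fun i hi => by rw [hz2 i hi]
    refine le_trans ?_ (le_iSup₂ (f := fun v (_ : v ∈ weightSet n k ∩ momentSet g n k θ₀ θ₀) =>
      weightProd n k v) z hz)
    refine ENNReal.ofReal_le_ofReal ?_
    rw [Finset.prod_congr rfl hz1, Finset.prod_congr rfl hz2]
    rw [hc1] at hvp
    have h1 := (mul_le_mul_of_nonneg_left (hM hN1) (by positivity)).trans hvp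
    have h2 := (mul_le_mul_of_nonneg_left (hM hN2') (by positivity)).trans hvp'
    refine le_trans (le_of_eq ?_) (mul_le_mul h1 h2 (by positivity)
      ((by positivity : (0 : ℝ) ≤ _).trans h1))
    have : Real.exp (-(4 * L ^ 2 / (c * N))) =
        Real.exp (-(2 * L ^ 2 / (c * N))) * Real.exp (-(2 * L ^ 2 / (c * N))) := by
      rw [← Real.exp_add]; congr 1; ring
    rw [this, hQ]; ring
  -- the upper bound at `θ`; on the second segment the multiplier `0` suffices
  have hup : empLik g n k θ θ ≤ ENNReal.ofReal (Q * Real.exp (-(inner ℝ μ (∑ i ∈ Finset.Icc 1 k,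
      g i θ) - 2 * ∑ i ∈ Finset.Icc 1 k, inner ℝ μ (g i θ) ^ 2))) := by
    refine iSup₂_le fun z hz => ENNReal.ofReal_le_ofReal ?_
    have hz0 : ∀ i ∈ Finset.Icc 1 n, 0 ≤ z i := fun i hi => (hz.1.1 i hi).1
    have h1 := prod_weights_le hs1 (v := z) (x := fun i => inner ℝ μ (g i θ))
      (fun i hi => hz0 i (hsub1 hi)) hz.1.2.1 hμ (by
        have := congrArg (fun y => (inner ℝ μ y : ℝ)) hz.2.1
        simpa only [inner_sum, inner_smul_right, inner_zero_right] using this)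
    have h2 := prod_weights_le hs2 (v := z) (x := fun _ => 0)
      (fun i hi => hz0 i (hsub2 hi)) hz.1.2.2 (by simp) (by simp)
    rw [hc1] at h1
    simp only [Finset.sum_const_zero, ne_eq, OfNat.ofNat_ne_zero, not_false_eq_true, zero_pow,
      mul_zero, sub_zero, neg_zero, Real.exp_zero, mul_one] at h2
    rw [inner_sum]
    refine (mul_le_mul h1 h2 (Finset.prod_nonneg fun i hi => hz0 i (hsub2 hi))
      (by positivity)).trans (le_of_eq ?_)
    rw [hQ]; ring
  refine hup.trans_lt (lt_of_lt_of_le ?_ hlow)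
  rw [ENNReal.ofReal_lt_ofReal_iff (by positivity)]
  refine mul_lt_mul_of_pos_left (Real.exp_lt_exp.2 ?_) hQ0
  linarith

/-! ### Causality of the stationary autoregression -/

lemma tendsto_norm_pow_zero_of_spectralRadius_lt_one {A : Type*} [NormedRing A]
    [NormedAlgebra ℂ A] [CompleteSpace A] (a : A) (h : spectralRadius ℂ a < 1) :
    Tendsto (fun n : ℕ => ‖a ^ n‖) atTop (𝓝 0) := by
  obtain ⟨r, hr1, hr2⟩ := ENNReal.lt_iff_exists_nnreal_btwn.1 h
  have hr : (r : ℝ) < 1 := by exact_mod_cast hr2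
  have hlim := (spectrum.pow_norm_pow_one_div_tendsto_nhds_spectralRadius a).eventually_lt_const hr1
  refine squeeze_zero' (Eventually.of_forall fun _ => norm_nonneg _) ?_
    (tendsto_pow_atTop_nhds_zero_of_lt_one r.2 hr)
  filter_upwards [hlim, eventually_gt_atTop 0] with n hn hn0
  have h1 : ‖a ^ n‖ ^ (1 / n : ℝ) ≤ r := by
    have := (ENNReal.ofReal_le_ofReal_iff r.2).1 (by simpa using hn.le :
      ENNReal.ofReal (‖a ^ n‖ ^ (1 / n : ℝ)) ≤ ENNReal.ofReal (r : ℝ))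
    exact this
  have hn0' : (n : ℝ) ≠ 0 := by positivity
  calc ‖a ^ n‖ = (‖a ^ n‖ ^ (1 / n : ℝ)) ^ n := by
        rw [← Real.rpow_natCast, ← Real.rpow_mul (norm_nonneg _), one_div,
          inv_mul_cancel₀ hn0', Real.rpow_one]
    _ ≤ _ := pow_le_pow_left₀ (Real.rpow_nonneg (norm_nonneg _) _) h1 n

/-- The companion operator of the autoregressive polynomial `1 - ∑ i, β i z ^ (i + 1)`. It maps
the vector of lagged values at one time to that of the next time, up to the innovation. -/
noncomputable def companion {p : ℕ} (β : EuclideanSpace ℝ (Fin p)) :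
    (Fin p → ℂ) →L[ℂ] (Fin p → ℂ) :=
  LinearMap.toContinuousLinearMap
    { toFun := fun x i => if _h : (i : ℕ) = 0 then ∑ j, ((β j : ℝ) : ℂ) * x j
        else x ⟨i - 1, by omega⟩
      map_add' := fun x x' => by
        ext i; dsimp only [Pi.add_apply]; split_ifs <;> simp [mul_add, Finset.sum_add_distrib]
      map_smul' := fun r x => by
        ext i; dsimp only [Pi.smul_apply, smul_eq_mul, RingHom.id_apply]
        split_ifs
        · rw [Finset.mul_sum]; exact Finset.sum_congr rfl fun j _ => by ring
        · rfl }

lemma companion_apply {p : ℕ} (β : EuclideanSpace ℝ (Fin p)) (x : Fin p → ℂ) (i : Fin p) :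
    companion β x i = if _h : (i : ℕ) = 0 then ∑ j, ((β j : ℝ) : ℂ) * x j
        else x ⟨i - 1, by omega⟩ := rfl

lemma tendsto_companion_pow {p : ℕ} [NeZero p] (β : EuclideanSpace ℝ (Fin p))
    (hroots : ∀ z : ℂ, ‖z‖ ≤ 1 → 1 - ∑ i : Fin p, ((β i : ℝ) : ℂ) * z ^ ((i : ℕ) + 1) ≠ 0) :
    Tendsto (fun n : ℕ => ‖companion β ^ n‖) atTop (𝓝 0) := by
  refine tendsto_norm_pow_zero_of_spectralRadius_lt_one _ ?_
  have : Nonempty (Fin p) := ⟨0⟩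
  refine spectrum.spectralRadius_lt_of_forall_lt (r := 1) _ fun z hz => ?_
  rw [← NNReal.coe_lt_coe, coe_nnnorm, NNReal.coe_one]
  by_contra! hz1
  have hz0 : z ≠ 0 := by rintro rfl; norm_num at hz1
  have hcomp : IsCompactOperator (companion β) := isCompactOperator_of_locallyCompactSpace_dom
    (companion β)
  obtain ⟨x, hx⟩ := ((hcomp.hasEigenvalue_iff_mem_spectrum hz0).2 hz).exists_hasEigenvector
  have hxz : ∀ i, companion β x i = z * x i := fun i => by
    have := congrFun hx.apply_eq_smul i
    simpa using this
  -- an eigenvector is a multiple of the vector of powers of `z⁻¹`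
  have hpow : ∀ (m : ℕ) (hm : m < p), x ⟨m, hm⟩ = z⁻¹ ^ m * x 0 := by
    intro m
    induction m with
    | zero => intro hm; rw [pow_zero, one_mul]; rfl
    | succ m ih =>
      intro hm
      have := hxz ⟨m + 1, hm⟩
      rw [companion_apply, dif_neg (by simp)] at this
      simp only [Nat.add_sub_cancel] at this
      rw [ih (by omega)] at this
      rw [pow_succ', mul_assoc, this, inv_mul_cancel_left₀ hz0]
  have hx0 : x 0 ≠ 0 := fun h0 => hx.2 <| by
    ext ⟨m, hm⟩; rw [hpow m hm, h0, mul_zero]; rfl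
  refine hroots z⁻¹ (by rw [norm_inv]; exact inv_le_one_of_one_le₀ hz1) ?_
  have h0 := hxz 0
  rw [companion_apply, dif_pos (by simp)] at h0
  have h1 : (∑ i : Fin p, ((β i : ℝ) : ℂ) * z⁻¹ ^ ((i : ℕ) + 1)) * x 0 = 1 * x 0 := by
    calc _ = z⁻¹ * ∑ i : Fin p, ((β i : ℝ) : ℂ) * x i := by
          rw [Finset.sum_mul, Finset.mul_sum]
          exact Finset.sum_congr rfl fun i _ => by rw [hpow i i.2]; ring
      _ = _ := by rw [h0, inv_mul_cancel_left₀ hz0, one_mul]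
  rw [mul_right_cancel₀ hx0 h1, sub_self]

variable {Ω : Type*} [MeasurableSpace Ω] {P : Measure Ω}

/-- Functionals of the path of a stationary process have a law that is invariant under shifts. -/
lemma IsStrictlyStationary.identDistrib {y : ℤ → Ω → ℝ} (h : IsStrictlyStationary P y)
    (hy : ∀ t, Measurable (y t)) {E : Type*} [MeasurableSpace E] {F : (ℤ → ℝ) → E}
    (hF : Measurable F) (t : ℤ) :
    IdentDistrib (fun ω => F fun s => y (s + t) ω) (fun ω => F fun s => y s ω) P P := by
  have h1 : IdentDistrib (fun ω s => y (s + t) ω) (fun ω s => y s ω) P P :=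
    ⟨(measurable_pi_lambda _ fun s => hy _).aemeasurable,
      (measurable_pi_lambda _ fun s => hy _).aemeasurable, h t⟩
  exact h1.comp hF

/-- A stationary causal autoregression is, up to a null set, a function of the present and past
innovations: iterate the equation; the contribution of the initial value vanishes in
probability. -/
lemma exists_measurable_past [IsProbabilityMeasure P] {p : ℕ} [NeZero p]
    {β : EuclideanSpace ℝ (Fin p)}
    (hroots : ∀ z : ℂ, ‖z‖ ≤ 1 → 1 - ∑ i : Fin p, ((β i : ℝ) : ℂ) * z ^ ((i : ℕ) + 1) ≠ 0)
    {e y : ℤ → Ω → ℝ} (hy : ∀ t, Measurable (y t)) (hstat : IsStrictlyStationary P y)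
    (hAR : ∀ (t : ℤ) (ω : Ω),
      y t ω = inner ℝ (lagVec p (fun s => y s ω) (t - 1)) β + e t ω) (t : ℤ) :
    ∃ z : Ω → ℝ, Measurable[⨆ s ∈ Set.Iic t, MeasurableSpace.comap (e s) inferInstance] z ∧
      y t =ᵐ[P] z := by
  set A := companion β
  let X : ℤ → Ω → Fin p → ℂ := fun t ω i => ((y (t - (i : ℤ)) ω : ℝ) : ℂ)
  let ε : ℤ → Ω → Fin p → ℂ := fun t ω => Pi.single 0 ((e t ω : ℝ) : ℂ)
  have hXm : ∀ t, Measurable (X t) := fun t => measurable_pi_lambda _ fun i =>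
    Complex.measurable_ofReal.comp (hy _)
  have hstep : ∀ t ω, X t ω = A (X (t - 1) ω) + ε t ω := fun t ω => by
    ext i
    simp only [Pi.add_apply, A, companion_apply, X, ε]
    split_ifs with h
    · have hi : i = 0 := Fin.ext h
      subst hi
      rw [Pi.single_eq_same]
      have := hAR t ω
      simp only [Fin.val_zero, Nat.cast_zero, sub_zero, this, Complex.ofReal_add]
      congr 1
      rw [PiLp.inner_apply]
      push_cast
      refine Finset.sum_congr rfl fun j _ => ?_
      simp [lagVec]
    · have hi : i ≠ 0 := fun h' => h (by rw [h']; rfl)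
      rw [Pi.single_eq_of_ne hi, add_zero]
      have h1 : (((i : ℕ) - 1 : ℕ) : ℤ) = (i : ℤ) - 1 := by omega
      rw [h1, sub_sub, add_sub_cancel]
  have hiter : ∀ (N : ℕ) ω, X t ω = (A ^ N) (X (t - N) ω) +
      ∑ j ∈ Finset.range N, (A ^ j) (ε (t - j) ω) := by
    intro N ω
    induction N with
    | zero => simp
    | succ N ih =>
      rw [ih, Finset.sum_range_succ, hstep (t - N) ω, map_add, pow_succ]
      rw [show t - ((N + 1 : ℕ) : ℤ) = t - N - 1 by push_cast; ring]
      simp only [mul_apply_eq_comp]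
      abel
  have hA : Tendsto (fun n : ℕ => ‖A ^ n‖) atTop (𝓝 0) := tendsto_companion_pow β hroots
  -- the remainder tends to zero in probability, because its law is that of `A ^ N (X t)`
  have hmeas : TendstoInMeasure P (fun (N : ℕ) ω => (A ^ N) (X (t - N) ω)) atTop
      (fun _ => (0 : Fin p → ℂ)) := by
    have h0 : TendstoInMeasure P (fun (N : ℕ) ω => (A ^ N) (X t ω)) atTop
        (fun _ => (0 : Fin p → ℂ)) := by
      refine tendstoInMeasure_of_tendsto_ae
        (fun N => ((A ^ N).continuous.measurable.comp (hXm t)).aestronglyMeasurable)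
        (ae_of_all _ fun ω => ?_)
      refine squeeze_zero_norm (fun N => (A ^ N).le_opNorm _) ?_
      simpa using hA.mul_const ‖X t ω‖
    refine fun δ hδ => (h0 δ hδ).congr fun N => ?_
    have hid : IdentDistrib (X (t - N)) (X t) P P := by
      have := hstat.identDistrib hy (F := fun y (i : Fin p) => ((y (t - (i : ℤ)) : ℝ) : ℂ))
        (measurable_pi_lambda _ fun i => Complex.measurable_ofReal.comp (measurable_pi_apply _))
        (-N : ℤ)
      simp only [show ∀ i : Fin p, t - (i : ℤ) + -(N : ℤ) = t - N - (i : ℤ) by intro i; ring]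
        at this
      exact this
    exact ((hid.comp (u := fun x => edist ((A ^ N) x) 0)
      (((A ^ N).continuous.measurable).edist measurable_const)).measure_mem_eq
        measurableSet_Ici).symm
  obtain ⟨ns, -, hns⟩ := hmeas.exists_seq_tendsto_ae
  let W : ℕ → Ω → ℝ := fun N ω => ((∑ j ∈ Finset.range N, (A ^ j) (ε (t - j) ω)) 0).re
  have hWm : ∀ N, Measurable[⨆ s ∈ Set.Iic t, MeasurableSpace.comap (e s) inferInstance] (W N) := by
    intro N
    have hW : W N = fun ω => ∑ j ∈ Finset.range N,
        (((A ^ j) (Pi.single 0 ((e (t - j) ω : ℝ) : ℂ))) 0).re := by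
      ext ω; simp only [W, ε, Finset.sum_apply, Complex.re_sum]
    rw [hW]
    refine Finset.measurable_fun_sum _ fun j _ => ?_
    have he : Measurable[⨆ s ∈ Set.Iic t, MeasurableSpace.comap (e s) inferInstance]
        (e (t - j)) := by
      have : t - (j : ℤ) ∈ Set.Iic t := by simp
      exact Measurable.mono (comap_measurable _)
        (le_iSup₂ (f := fun s (_ : s ∈ Set.Iic t) => MeasurableSpace.comap (e s) inferInstance)
          _ this) le_rfl
    have hc : Measurable fun r : ℝ => (((A ^ j) (Pi.single 0 (r : ℂ))) 0).re := by
      refine Continuous.measurable ?_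
      have h1 : Continuous fun r : ℝ => (Pi.single 0 (r : ℂ) : Fin p → ℂ) :=
        (continuous_single (A := fun _ : Fin p => ℂ) 0).comp Complex.continuous_ofReal
      exact Complex.continuous_re.comp ((continuous_apply 0).comp ((A ^ j).continuous.comp h1))
    exact hc.comp he
  refine ⟨fun ω => limsup (fun k => W (ns k) ω) atTop, ?_, ?_⟩
  · exact Measurable.limsup fun k => hWm (ns k)
  · filter_upwards [hns] with ω hω
    refine (Tendsto.limsup_eq ?_).symm
    have h1 : ∀ k, W (ns k) ω = y t ω - ((A ^ (ns k)) (X (t - ns k) ω) 0).re := fun k => by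
      have := congrArg (fun x : Fin p → ℂ => (x 0).re) (hiter (ns k) ω)
      simp only [Pi.add_apply, Complex.add_re] at this
      simp only [W]
      have h2 : (X t ω 0).re = y t ω := by simp [X]
      rw [← h2, this]; ring
    simp only [h1]
    have h3 : Tendsto (fun k => ((A ^ (ns k)) (X (t - ns k) ω) 0).re) atTop (𝓝 0) := by
      exact (Complex.continuous_re.tendsto _).comp
        (((continuous_apply (0 : Fin p)).tendsto _).comp hω)
    simpa using h3.const_sub (y t ω)

/-- The innovation at time `t` is independent of the path of the process before time `t`. -/
lemma indepFun_past [IsProbabilityMeasure P] {p : ℕ} [NeZero p]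
    {β : EuclideanSpace ℝ (Fin p)}
    (hroots : ∀ z : ℂ, ‖z‖ ≤ 1 → 1 - ∑ i : Fin p, ((β i : ℝ) : ℂ) * z ^ ((i : ℕ) + 1) ≠ 0)
    {e y : ℤ → Ω → ℝ} (he : ∀ t, Measurable (e t)) (hy : ∀ t, Measurable (y t))
    (hindep : iIndepFun e P) (hstat : IsStrictlyStationary P y)
    (hAR : ∀ (t : ℤ) (ω : Ω),
      y t ω = inner ℝ (lagVec p (fun s => y s ω) (t - 1)) β + e t ω) (t : ℤ) :
    IndepFun (fun ω (s : Set.Iio t) => y s ω) (e t) P := by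
  choose z hzm hz using exists_measurable_past hroots hy hstat hAR
  have hI : Indep (⨆ s ∈ Set.Iio t, MeasurableSpace.comap (e s) inferInstance)
      (⨆ s ∈ ({t} : Set ℤ), MeasurableSpace.comap (e s) inferInstance) P :=
    indep_iSup_of_disjoint (fun s => (he s).comap_le) hindep (by simp)
  have h1 : IndepFun (fun ω (s : Set.Iio t) => z s ω) (e t) P := by
    rw [IndepFun_iff_Indep]
    refine indep_of_indep_of_le_left (indep_of_indep_of_le_right hI ?_) ?_
    · exact le_iSup₂ (f := fun s (_ : s ∈ ({t} : Set ℤ)) =>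
        MeasurableSpace.comap (e s) inferInstance) t rfl
    · refine Measurable.comap_le ?_
      refine @measurable_pi_lambda _ _ _
        (⨆ s ∈ Set.Iio t, MeasurableSpace.comap (e s) inferInstance)
        _ _ fun s => (hzm s).mono ?_ le_rfl
      exact biSup_mono fun r hr => lt_of_le_of_lt (Set.mem_Iic.1 hr) s.2
  refine h1.congr ?_ (ae_eq_refl _)
  have : ∀ᵐ ω ∂P, ∀ s : Set.Iio t, z s ω = y s ω :=
    ae_all_iff.2 fun s => (hz s).symm
  filter_upwards [this] with ω hω
  exact funext hω

/-! ### Second moments: Chebyshev bounds and a weak law for mixing events -/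

lemma measureReal_abs_ge_le [IsFiniteMeasure P] {S : Ω → ℝ} (hS : Integrable (fun ω => S ω ^ 2) P)
    {δ : ℝ} (hδ : 0 < δ) : P.real {ω | δ ≤ |S ω|} ≤ (∫ ω, S ω ^ 2 ∂P) / δ ^ 2 := by
  rw [le_div_iff₀ (by positivity), mul_comm]
  have h := mul_meas_ge_le_integral_of_nonneg (μ := P) (ae_of_all _ fun ω => sq_nonneg (S ω)) hS
    (δ ^ 2)
  have hset : {ω | δ ≤ |S ω|} = {ω | δ ^ 2 ≤ S ω ^ 2} := by
    ext ω
    rw [Set.mem_ofPred_eq, Set.mem_ofPred_eq, ← sq_abs (S ω),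
      pow_le_pow_iff_left₀ hδ.le (abs_nonneg _) two_ne_zero]
  rwa [hset]

/-- A sequence of identically distributed regressors `X i` and identically distributed errors
`e i`, each error being independent of the present regressor together with any one earlier pair.
These are the properties of the causal autoregression which make the centred functions of the
errors, weighted by functions of the regressors, uncorrelated. -/
structure IsCausalRegression {𝒳 : Type*} [MeasurableSpace 𝒳] (P : Measure Ω) (X : ℕ → Ω → 𝒳)
    (e : ℕ → Ω → ℝ) : Prop where
  measurable_regressor : ∀ i, Measurable (X i)
  measurable_error : ∀ i, Measurable (e i)
  identDistrib_regressor : ∀ i, IdentDistrib (X i) (X 0) P P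
  identDistrib_error : ∀ i, IdentDistrib (e i) (e 0) P P
  indepFun : ∀ i, IndepFun (X i) (e i) P
  indepFun_past : ∀ i j, i < j → IndepFun (fun ω => (X i ω, e i ω, X j ω)) (e j) P

namespace IsCausalRegression

variable {𝒳 : Type*} [MeasurableSpace 𝒳] {X : ℕ → Ω → 𝒳} {e : ℕ → Ω → ℝ}

lemma memLp [IsProbabilityMeasure P] (h : IsCausalRegression P X e) {f : 𝒳 → ℝ} {ξ : ℝ → ℝ}
    (hf : Measurable f) (hξ : Measurable ξ) (hξ1 : ∀ x, |ξ x| ≤ 1)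
    (hf2 : Integrable (fun ω => f (X 0 ω) ^ 2) P) (i : ℕ) :
    MemLp (fun ω => f (X i ω) * ξ (e i ω)) 2 P := by
  have h1 : MemLp (fun ω => f (X i ω)) 2 P := by
    refine (memLp_two_iff_integrable_sq
      (hf.comp (h.measurable_regressor i)).aestronglyMeasurable).2 ?_
    exact (((h.identDistrib_regressor i).comp (hf.pow_const 2)).integrable_iff).2 hf2
  refine h1.mono ((hf.comp (h.measurable_regressor i)).mul
    (hξ.comp (h.measurable_error i))).aestronglyMeasurable (ae_of_all _ fun ω => ?_)
  rw [norm_mul]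
  exact mul_le_of_le_one_right (norm_nonneg _) (hξ1 _)

/-- Orthogonality of martingale differences. -/
lemma integral_sum_sq [IsProbabilityMeasure P] (h : IsCausalRegression P X e) {f : 𝒳 → ℝ}
    {ξ : ℝ → ℝ} (hf : Measurable f) (hξ : Measurable ξ) (hξ1 : ∀ x, |ξ x| ≤ 1)
    (hf2 : Integrable (fun ω => f (X 0 ω) ^ 2) P) (hξ0 : ∫ ω, ξ (e 0 ω) ∂P = 0) (I : Finset ℕ) :
    Integrable (fun ω => (∑ i ∈ I, f (X i ω) * ξ (e i ω)) ^ 2) P ∧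
    ∫ ω, (∑ i ∈ I, f (X i ω) * ξ (e i ω)) ^ 2 ∂P =
      I.card * ((∫ ω, f (X 0 ω) ^ 2 ∂P) * ∫ ω, ξ (e 0 ω) ^ 2 ∂P) := by
  have hL := h.memLp hf hξ hξ1 hf2
  have hfm : ∀ i, Measurable fun ω => f (X i ω) := fun i => hf.comp (h.measurable_regressor i)
  have hξm : ∀ i, Measurable fun ω => ξ (e i ω) := fun i => hξ.comp (h.measurable_error i)
  have hint : ∀ i j, Integrable (fun ω => (f (X i ω) * ξ (e i ω)) * (f (X j ω) * ξ (e j ω))) P :=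
    fun i j => (hL i).integrable_mul (hL j)
  have hlt : ∀ i j, i < j →
      ∫ ω, (f (X i ω) * ξ (e i ω)) * (f (X j ω) * ξ (e j ω)) ∂P = 0 := fun i j hij => by
    have hI : IndepFun (fun ω => f (X i ω) * ξ (e i ω) * f (X j ω)) (fun ω => ξ (e j ω)) P :=
      (h.indepFun_past i j hij).comp (φ := fun z : 𝒳 × ℝ × 𝒳 => f z.1 * ξ z.2.1 * f z.2.2)
        (((hf.comp measurable_fst).mul (hξ.comp (measurable_fst.comp measurable_snd))).mul
          (hf.comp (measurable_snd.comp measurable_snd))) hξ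
    have := hI.integral_fun_mul_eq_mul_integral
      (((hfm i).mul (hξm i)).mul (hfm j)).aestronglyMeasurable (hξm j).aestronglyMeasurable
    have h0 : ∫ ω, ξ (e j ω) ∂P = 0 := by
      rw [← hξ0]; exact ((h.identDistrib_error j).comp hξ).integral_eq
    rw [h0, mul_zero] at this
    rw [← this]
    exact integral_congr_ae (ae_of_all _ fun ω => by simp only; ring)
  have hdiag : ∀ i, ∫ ω, (f (X i ω) * ξ (e i ω)) * (f (X i ω) * ξ (e i ω)) ∂P =
      (∫ ω, f (X 0 ω) ^ 2 ∂P) * ∫ ω, ξ (e 0 ω) ^ 2 ∂P := fun i => by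
    have hI : IndepFun (fun ω => f (X i ω) ^ 2) (fun ω => ξ (e i ω) ^ 2) P :=
      (h.indepFun i).comp (hf.pow_const 2) (hξ.pow_const 2)
    have := hI.integral_fun_mul_eq_mul_integral
      ((hfm i).pow_const 2).aestronglyMeasurable ((hξm i).pow_const 2).aestronglyMeasurable
    have h1 : ∫ ω, ξ (e i ω) ^ 2 ∂P = ∫ ω, ξ (e 0 ω) ^ 2 ∂P :=
      ((h.identDistrib_error i).comp (hξ.pow_const 2)).integral_eq
    have h2 : ∫ ω, f (X i ω) ^ 2 ∂P = ∫ ω, f (X 0 ω) ^ 2 ∂P :=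
      ((h.identDistrib_regressor i).comp (hf.pow_const 2)).integral_eq
    rw [← h1, ← h2, ← this]
    exact integral_congr_ae (ae_of_all _ fun ω => by simp only; ring)
  simp only [sq (∑ i ∈ I, _), Finset.sum_mul_sum]
  refine ⟨integrable_finsetSum _ fun i _ => integrable_finsetSum _ fun j _ => hint i j, ?_⟩
  rw [integral_finsetSum _ fun i _ => integrable_finsetSum _ fun j _ => hint i j]
  rw [Finset.sum_congr rfl fun i _ => integral_finsetSum I fun j _ => hint i j]
  rw [← nsmul_eq_mul, ← Finset.sum_const]
  refine Finset.sum_congr rfl fun i hi => ?_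
  rw [Finset.sum_eq_single_of_mem i hi, hdiag]
  intro j _ hji
  rcases lt_or_gt_of_ne hji with hlt' | hlt'
  · rw [← hlt j i hlt']
    exact integral_congr_ae (ae_of_all _ fun ω => by simp only; ring)
  · exact hlt i j hlt'

lemma measureReal_sum_ge_le [IsProbabilityMeasure P] (h : IsCausalRegression P X e) {f : 𝒳 → ℝ}
    (hf : Measurable f) (hf0 : ∀ x, 0 ≤ f x) (hfi : Integrable (fun ω => f (X 0 ω)) P)
    (I : Finset ℕ) {δ : ℝ} (hδ : 0 < δ) :
    P.real {ω | δ ≤ ∑ i ∈ I, f (X i ω)} ≤ I.card * (∫ ω, f (X 0 ω) ∂P) / δ := by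
  have hint : ∀ i, Integrable (fun ω => f (X i ω)) P := fun i =>
    (((h.identDistrib_regressor i).comp hf).integrable_iff).2 hfi
  have h1 := mul_meas_ge_le_integral_of_nonneg (μ := P) (f := fun ω => ∑ i ∈ I, f (X i ω))
    (ae_of_all _ fun ω => Finset.sum_nonneg fun i _ => hf0 _)
    (integrable_finsetSum _ fun i _ => hint i) δ
  rw [integral_finsetSum _ fun i _ => hint i] at h1
  have h2 : ∀ i ∈ I, ∫ ω, f (X i ω) ∂P = ∫ ω, f (X 0 ω) ∂P :=
    fun i _ => ((h.identDistrib_regressor i).comp hf).integral_eq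
  rw [Finset.sum_congr rfl h2, Finset.sum_const, nsmul_eq_mul] at h1
  rw [le_div_iff₀ hδ, mul_comm]
  exact h1

/-- Deviations of the number of visits of the pair `(X i, e i)` to a rectangle `A × J` from its
conditional mean. -/
lemma measureReal_count_dev_le [IsProbabilityMeasure P] (h : IsCausalRegression P X e)
    {A : Set 𝒳} {J : Set ℝ} (hA : MeasurableSet A) (hJ : MeasurableSet J) (I : Finset ℕ) {δ : ℝ}
    (hδ : 0 < δ) :
    P.real {ω | δ ≤ |∑ i ∈ I, A.indicator (fun _ => (1 : ℝ)) (X i ω) *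
      (J.indicator (fun _ => (1 : ℝ)) (e i ω) - P.real (e 0 ⁻¹' J))|} ≤
      I.card * P.real (e 0 ⁻¹' J) / δ ^ 2 := by
  set π := P.real (e 0 ⁻¹' J)
  have hπ0 : 0 ≤ π := measureReal_nonneg
  have hπ1 : π ≤ 1 := measureReal_le_one
  have hf : Measurable (A.indicator (fun _ => (1 : ℝ))) := measurable_const.indicator hA
  have hJm : Measurable (J.indicator (fun _ => (1 : ℝ))) := measurable_const.indicator hJ
  have hξ : Measurable fun x => J.indicator (fun _ => (1 : ℝ)) x - π := hJm.sub_const π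
  have hfb : ∀ x, A.indicator (fun _ => (1 : ℝ)) x ^ 2 ≤ 1 := fun x => by
    by_cases hx : x ∈ A <;> simp [hx]
  have hξb : ∀ x, |J.indicator (fun _ => (1 : ℝ)) x - π| ≤ 1 := fun x => by
    by_cases hx : x ∈ J <;> simp only [hx, Set.indicator_of_mem, Set.indicator_of_notMem,
      not_false_eq_true, abs_le] <;> constructor <;> linarith
  have hfi : Integrable (fun ω => A.indicator (fun _ => (1 : ℝ)) (X 0 ω) ^ 2) P := by
    refine Integrable.of_bound
      ((hf.comp (h.measurable_regressor 0)).pow_const 2).aestronglyMeasurable 1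
      (ae_of_all _ fun ω => ?_)
    rw [Real.norm_of_nonneg (sq_nonneg _)]; exact hfb _
  have hJi : Integrable (fun ω => J.indicator (fun _ => (1 : ℝ)) (e 0 ω)) P := by
    refine Integrable.of_bound (hJm.comp (h.measurable_error 0)).aestronglyMeasurable 1
      (ae_of_all _ fun ω => ?_)
    by_cases hx : e 0 ω ∈ J <;> simp [hx]
  have hJint : ∫ ω, J.indicator (fun _ => (1 : ℝ)) (e 0 ω) ∂P = π := by
    have : (fun ω => J.indicator (fun _ => (1 : ℝ)) (e 0 ω)) =
      (e 0 ⁻¹' J).indicator (fun _ => (1 : ℝ)) := rfl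
    rw [this, integral_indicator_const _ (h.measurable_error 0 hJ), smul_eq_mul, mul_one]
  have hξ0 : ∫ ω, (J.indicator (fun _ => (1 : ℝ)) (e 0 ω) - π) ∂P = 0 := by
    rw [integral_sub hJi (integrable_const _), hJint]; simp
  obtain ⟨h1, h2⟩ := h.integral_sum_sq hf hξ hξb hfi hξ0 I
  refine (measureReal_abs_ge_le h1 hδ).trans ?_
  rw [h2]
  gcongr
  have h3 : ∫ ω, A.indicator (fun _ => (1 : ℝ)) (X 0 ω) ^ 2 ∂P ≤ 1 := by
    refine (integral_mono hfi (integrable_const 1) fun ω => hfb _).trans ?_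
    simp
  have h4 : ∫ ω, (J.indicator (fun _ => (1 : ℝ)) (e 0 ω) - π) ^ 2 ∂P ≤ π := by
    have : ∀ ω, (J.indicator (fun _ => (1 : ℝ)) (e 0 ω) - π) ^ 2 =
        (1 - 2 * π) * J.indicator (fun _ => (1 : ℝ)) (e 0 ω) + π ^ 2 := fun ω => by
      by_cases hx : e 0 ω ∈ J <;> simp only [hx, Set.indicator_of_mem, Set.indicator_of_notMem,
        not_false_eq_true] <;> ring
    simp only [this]
    rw [integral_add (hJi.const_mul _) (integrable_const _), integral_const_mul, hJint]
    simp only [integral_const, probReal_univ, smul_eq_mul, one_mul]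
    nlinarith
  calc _ ≤ 1 * π := mul_le_mul h3 h4 (integral_nonneg fun ω => sq_nonneg _) zero_le_one
    _ = π := one_mul _

end IsCausalRegression

lemma alphaMixing_bddAbove {E : Type*} [mE : MeasurableSpace E] [IsProbabilityMeasure P]
    (v : ℤ → Ω → E) (l : ℕ) :
    BddAbove {c : ℝ | ∃ (t : ℤ) (A B : Set Ω),
      MeasurableSet[⨆ s : {s : ℤ // s ≤ t}, mE.comap (v s)] A ∧
      MeasurableSet[⨆ s : {s : ℤ // t + l ≤ s}, mE.comap (v s)] B ∧
      c = |P.real (A ∩ B) - P.real A * P.real B|} := by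
  refine ⟨1, ?_⟩
  rintro c ⟨t, A, B, -, -, rfl⟩
  have h1 : P.real A * P.real B ≤ 1 :=
    mul_le_one₀ measureReal_le_one measureReal_nonneg measureReal_le_one
  have h2 : 0 ≤ P.real A * P.real B := by positivity
  have h3 : P.real (A ∩ B) ≤ 1 := measureReal_le_one
  have h4 : 0 ≤ P.real (A ∩ B) := measureReal_nonneg
  exact abs_le.2 ⟨by linarith, by linarith⟩

lemma abs_cov_le_alphaMixing {E : Type*} [MeasurableSpace E] [IsProbabilityMeasure P]
    (v : ℤ → Ω → E) {D : Set E} (hD : MeasurableSet D) (t : ℤ) (l : ℕ) :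
    |P.real (v t ⁻¹' D ∩ v (t + l) ⁻¹' D) - P.real (v t ⁻¹' D) * P.real (v (t + l) ⁻¹' D)| ≤
      alphaMixing P v l := by
  refine le_csSup (alphaMixing_bddAbove v l) ⟨t, _, _, ?_, ?_, rfl⟩
  · exact le_iSup (fun s : {s : ℤ // s ≤ t} => MeasurableSpace.comap (v s) inferInstance)
      ⟨t, le_rfl⟩ _ ⟨D, hD, rfl⟩
  · exact le_iSup (fun s : {s : ℤ // t + l ≤ s} => MeasurableSpace.comap (v s) inferInstance)
      ⟨t + l, le_rfl⟩ _ ⟨D, hD, rfl⟩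

/-- The weak law of large numbers for the visits of a strong mixing process to a set `D`, in
windows of growing length at arbitrary positions. -/
lemma tendsto_measureReal_count_le {E : Type*} [MeasurableSpace E] [IsProbabilityMeasure P]
    {v : ℤ → Ω → E} (hv : ∀ t, Measurable (v t)) (hmix : IsStrongMixing P v) {D : Set E}
    (hD : MeasurableSet D) {π : ℝ} (hπ : 0 < π) (hvD : ∀ t, P.real (v t ⁻¹' D) = π) (a N : ℕ → ℕ)
    (hN : Tendsto N atTop atTop) :
    Tendsto (fun n => P.real {ω | ∑ i ∈ Finset.Icc (a n + 1) (a n + N n),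
      D.indicator (fun _ => (1 : ℝ)) (v i ω) ≤ π / 2 * N n}) atTop (𝓝 0) := by
  have hα : Tendsto (fun m : ℕ => (m : ℝ)⁻¹ * ∑ l ∈ Finset.range m, alphaMixing P v l) atTop
      (𝓝 0) := hmix.cesaro
  have hα0 : ∀ l, 0 ≤ alphaMixing P v l := fun l =>
    (abs_nonneg _).trans (abs_cov_le_alphaMixing v hD 0 l)
  have hDm : ∀ t, MeasurableSet (v t ⁻¹' D) := fun t => hv t hD
  have hind : ∀ t, (fun ω => D.indicator (fun _ => (1 : ℝ)) (v t ω)) =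
      (v t ⁻¹' D).indicator (fun _ => (1 : ℝ)) := fun t => rfl
  have hint : ∀ t, Integrable (fun ω => D.indicator (fun _ => (1 : ℝ)) (v t ω)) P := fun t => by
    rw [hind]; exact (integrable_const 1).indicator (hDm t)
  have hint2 : ∀ s t, Integrable (fun ω => D.indicator (fun _ => (1 : ℝ)) (v s ω) *
      D.indicator (fun _ => (1 : ℝ)) (v t ω)) P ∧ ∫ ω, D.indicator (fun _ => (1 : ℝ)) (v s ω) *
      D.indicator (fun _ => (1 : ℝ)) (v t ω) ∂P = P.real (v s ⁻¹' D ∩ v t ⁻¹' D) := fun s t => by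
    have : (fun ω => D.indicator (fun _ => (1 : ℝ)) (v s ω) *
        D.indicator (fun _ => (1 : ℝ)) (v t ω)) =
        (v s ⁻¹' D ∩ v t ⁻¹' D).indicator (fun _ => (1 : ℝ)) := by
      ext ω
      by_cases h1 : v s ω ∈ D <;> by_cases h2 : v t ω ∈ D <;> simp [h1, h2]
    rw [this]
    refine ⟨(integrable_const 1).indicator ((hDm s).inter (hDm t)), ?_⟩
    rw [integral_indicator_const _ ((hDm s).inter (hDm t)), smul_eq_mul, mul_one]
  have hcov : ∀ s t, Integrable (fun ω => (D.indicator (fun _ => (1 : ℝ)) (v s ω) - π) *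
      (D.indicator (fun _ => (1 : ℝ)) (v t ω) - π)) P ∧
      ∫ ω, (D.indicator (fun _ => (1 : ℝ)) (v s ω) - π) *
      (D.indicator (fun _ => (1 : ℝ)) (v t ω) - π) ∂P =
      P.real (v s ⁻¹' D ∩ v t ⁻¹' D) - π * π := fun s t => by
    have he : ∀ ω, (D.indicator (fun _ => (1 : ℝ)) (v s ω) - π) *
        (D.indicator (fun _ => (1 : ℝ)) (v t ω) - π) =
        D.indicator (fun _ => (1 : ℝ)) (v s ω) * D.indicator (fun _ => (1 : ℝ)) (v t ω) -
        (π * D.indicator (fun _ => (1 : ℝ)) (v s ω) +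
          (π * D.indicator (fun _ => (1 : ℝ)) (v t ω) - π * π)) := fun ω => by ring
    have hi : ∀ t, ∫ ω, D.indicator (fun _ => (1 : ℝ)) (v t ω) ∂P = π := fun t => by
      rw [hind, integral_indicator_const _ (hDm t), smul_eq_mul, mul_one, hvD]
    have h1 : Integrable (fun ω => π * D.indicator (fun _ => (1 : ℝ)) (v t ω) - π * π) P :=
      ((hint t).const_mul π).sub (integrable_const (π * π))
    have h2 : Integrable (fun ω => π * D.indicator (fun _ => (1 : ℝ)) (v s ω) +
        (π * D.indicator (fun _ => (1 : ℝ)) (v t ω) - π * π)) P := ((hint s).const_mul π).add h1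
    simp only [he]
    refine ⟨(hint2 s t).1.sub h2, ?_⟩
    rw [integral_sub (hint2 s t).1 h2, (hint2 s t).2, integral_add ((hint s).const_mul π) h1,
      integral_sub ((hint t).const_mul π) (integrable_const _), integral_const_mul,
      integral_const_mul, hi, hi]
    simp
  have hle : ∀ s t : ℕ, s ≤ t → P.real (v s ⁻¹' D ∩ v t ⁻¹' D) - π * π ≤
      alphaMixing P v (t - s) := fun s t hst => by
    have h := abs_cov_le_alphaMixing (P := P) v hD s (t - s)
    rw [show (s : ℤ) + ((t - s : ℕ) : ℤ) = t by omega, hvD, hvD] at h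
    exact (le_abs_self _).trans h
  have hvar : ∀ n, Integrable (fun ω => (∑ i ∈ Finset.Icc (a n + 1) (a n + N n),
      (D.indicator (fun _ => (1 : ℝ)) (v i ω) - π)) ^ 2) P ∧
      ∫ ω, (∑ i ∈ Finset.Icc (a n + 1) (a n + N n),
      (D.indicator (fun _ => (1 : ℝ)) (v i ω) - π)) ^ 2 ∂P ≤
      N n * (2 * ∑ l ∈ Finset.range (N n), alphaMixing P v l) := fun n => by
    have hc : ∀ i j : ℕ, Integrable (fun ω => (D.indicator (fun _ => (1 : ℝ)) (v i ω) - π) *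
      (D.indicator (fun _ => (1 : ℝ)) (v j ω) - π)) P := fun i j => (hcov i j).1
    simp only [sq, Finset.sum_mul_sum]
    refine ⟨integrable_finsetSum _ fun i _ => integrable_finsetSum _ fun j _ => hc i j, ?_⟩
    rw [integral_finsetSum _ fun i _ => integrable_finsetSum _ fun j _ => hc i j]
    rw [Finset.sum_congr rfl fun i _ => integral_finsetSum _ fun j _ => hc i j]
    have hcard : (N n : ℝ) = ((Finset.Icc (a n + 1) (a n + N n)).card : ℕ) := by simp
    rw [hcard, ← nsmul_eq_mul, ← Finset.sum_const]
    refine Finset.sum_le_sum fun i hi => ?_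
    -- the indices on either side of `i` have distinct distances to `i`, all below the length
    rw [← Finset.sum_filter_add_sum_filter_not _ (fun j => j ≤ i), two_mul]
    have hi' := Finset.mem_Icc.1 hi
    refine add_le_add ?_ ?_
    · refine (Finset.sum_le_sum (g := fun j => alphaMixing P v (i - j)) fun j hj => ?_).trans ?_
      · rw [(hcov i j).2, Set.inter_comm]
        exact hle j i (Finset.mem_filter.1 hj).2
      · rw [← Finset.sum_image (f := fun l => alphaMixing P v l) (g := fun j => i - j)]
        · refine Finset.sum_le_sum_of_subset_of_nonneg (fun l hl => ?_) fun l _ _ => hα0 l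
          obtain ⟨j, hj, rfl⟩ := Finset.mem_image.1 hl
          have := Finset.mem_Icc.1 (Finset.mem_filter.1 hj).1
          exact Finset.mem_range.2 (by omega)
        · intro j hj j' hj' hjj
          have h1 := (Finset.mem_filter.1 hj).2
          have h2 := (Finset.mem_filter.1 hj').2
          simp only at hjj
          omega
    · refine (Finset.sum_le_sum (g := fun j => alphaMixing P v (j - i)) fun j hj => ?_).trans ?_
      · rw [(hcov i j).2]
        exact hle i j (not_le.1 (Finset.mem_filter.1 hj).2).le
      · rw [← Finset.sum_image (f := fun l => alphaMixing P v l) (g := fun j => j - i)]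
        · refine Finset.sum_le_sum_of_subset_of_nonneg (fun l hl => ?_) fun l _ _ => hα0 l
          obtain ⟨j, hj, rfl⟩ := Finset.mem_image.1 hl
          have := Finset.mem_Icc.1 (Finset.mem_filter.1 hj).1
          exact Finset.mem_range.2 (by omega)
        · intro j hj j' hj' hjj
          have h1 := (Finset.mem_filter.1 hj).2
          have h2 := (Finset.mem_filter.1 hj').2
          simp only at hjj
          omega
  -- the variance is at most `N * 2 * ∑ l < N, α l`, and Chebyshev is used at distance `π * N / 2`
  have hlim : Tendsto (fun n => (8 / π ^ 2) * ((N n : ℝ)⁻¹ * ∑ l ∈ Finset.range (N n),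
      alphaMixing P v l)) atTop (𝓝 0) := by
    simpa using (hα.comp hN).const_mul (8 / π ^ 2)
  refine squeeze_zero' (Eventually.of_forall fun _ => measureReal_nonneg) ?_ hlim
  filter_upwards [hN.eventually_gt_atTop 0] with n hn
  have hn' : (0 : ℝ) < N n := by exact_mod_cast hn
  have hcheb := measureReal_abs_ge_le (hvar n).1 (δ := π / 2 * N n) (by positivity)
  refine (measureReal_mono fun ω hω => ?_).trans (hcheb.trans ?_)
  · simp only [Set.mem_ofPred_eq, Finset.sum_sub_distrib, Finset.sum_const, Nat.card_Icc,
      nsmul_eq_mul] at hω ⊢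
    rw [show a n + N n + 1 - (a n + 1) = N n by omega, abs_sub_comm]
    refine le_trans ?_ (le_abs_self _)
    linarith
  · refine (div_le_div_of_nonneg_right (hvar n).2 (by positivity)).trans (le_of_eq ?_)
    field_simp
    ring

/-! ### Nondegeneracy of the moment functions, uniformly over directions -/

/-- The weak law of large numbers for the visits of `v` to sets of positive probability, as a
one-sided bound and for windows of growing length at arbitrary positions. -/
def SatisfiesCountLLN {E : Type*} [MeasurableSpace E] (P : Measure Ω) (v : ℕ → Ω → E) : Prop :=
  ∀ D : Set E, MeasurableSet D → 0 < P.real (v 0 ⁻¹' D) → ∀ a N : ℕ → ℕ, Tendsto N atTop atTop →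
    Tendsto (fun n => P.real {ω | ∑ i ∈ Finset.Icc (a n + 1) (a n + N n),
      D.indicator (fun _ => (1 : ℝ)) (v i ω) ≤ P.real (v 0 ⁻¹' D) / 2 * N n}) atTop (𝓝 0)

section Directions

variable {E : Type*} [NormedAddCommGroup E] [InnerProductSpace ℝ E]

/-- The bounded vectors whose component along `u` is bounded away from zero. The bound is `2 * η`,
so that `η` is left for the directions near `u`. -/
def directionSet (u : E) (η R : ℝ) : Set E := {z | 2 * η ≤ |inner ℝ u z| ∧ ‖z‖ ≤ R}

lemma measurableSet_directionSet [MeasurableSpace E] [BorelSpace E] (u : E) (η R : ℝ) :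
    MeasurableSet (directionSet u η R) := by
  refine IsClosed.measurableSet (IsClosed.inter ?_ ?_)
  · exact isClosed_le continuous_const (by fun_prop : Continuous fun z : E => |inner ℝ u z|)
  · exact isClosed_le continuous_norm continuous_const

lemma exists_directionSet_pos [MeasurableSpace E] [IsFiniteMeasure P]
    (v : Ω → E) {u : E} (hu : 0 < P.real {ω | inner ℝ u (v ω) ≠ 0}) :
    ∃ η R : ℝ, 0 < η ∧ 0 < R ∧ 0 < P.real (v ⁻¹' directionSet u η R) := by
  by_contra! hcon
  have h0 : ∀ n : ℕ, P (v ⁻¹' directionSet u (1 / (n + 1)) (n + 1)) = 0 := fun n => by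
    have := le_antisymm (hcon (1 / (n + 1)) (n + 1) (by positivity) (by positivity))
      measureReal_nonneg
    rwa [measureReal_eq_zero_iff] at this
  refine hu.ne' ((measureReal_eq_zero_iff).2 (measure_mono_null (fun ω hω => ?_)
    (measure_iUnion_null h0)))
  have hpos : 0 < |inner ℝ u (v ω)| := abs_pos.2 hω
  obtain ⟨n₁, hn₁⟩ := exists_nat_gt (2 / |inner ℝ u (v ω)|)
  obtain ⟨n₂, hn₂⟩ := exists_nat_gt ‖v ω‖
  refine Set.mem_iUnion.2 ⟨max n₁ n₂, ?_, ?_⟩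
  · have h1 : 2 / |inner ℝ u (v ω)| < (max n₁ n₂ : ℕ) + 1 :=
      hn₁.trans_le ((Nat.cast_le.2 (le_max_left _ _)).trans (by linarith))
    rw [div_lt_iff₀ hpos] at h1
    rw [mul_one_div, div_le_iff₀ (by positivity)]
    linarith
  · have : (n₂ : ℝ) ≤ (max n₁ n₂ : ℕ) := Nat.cast_le.2 (le_max_right _ _)
    linarith

lemma abs_inner_sub_le_of_mem_directionSet {u₀ u z : E} {η R : ℝ} (hR : 0 < R)
    (hz : z ∈ directionSet u₀ η R) (hu : u ∈ Metric.ball u₀ (η / R)) :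
    |inner ℝ u z - inner ℝ u₀ z| ≤ η := by
  rw [← inner_sub_left]
  refine (abs_real_inner_le_norm _ _).trans ?_
  have h1 : ‖u - u₀‖ < η / R := by rwa [← dist_eq_norm]
  calc ‖u - u₀‖ * ‖z‖ ≤ η / R * R := mul_le_mul h1.le hz.2 (norm_nonneg _)
        ((norm_nonneg _).trans h1.le)
    _ = η := div_mul_cancel₀ _ hR.ne'

lemma mem_directionSet_of_sign_smul_mem {u z : E} {η R s : ℝ} (hη : 0 < η)
    (h : Real.sign s • z ∈ directionSet u η R) : z ∈ directionSet u η R := by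
  obtain ⟨h1, h2⟩ := h
  have h3 : |Real.sign s| = 1 := by
    rcases Real.sign_apply_eq s with h | h | h
    · rw [h]; simp
    · rw [h, zero_smul, inner_zero_right, abs_zero] at h1; linarith
    · rw [h]; simp
  rw [inner_smul_right, abs_mul, h3, one_mul] at h1
  rw [norm_smul, Real.norm_eq_abs, h3, one_mul] at h2
  exact ⟨h1, h2⟩

/-- The smallest eigenvalue of the second moment matrix over a window stays away from zero. The
unit sphere is covered by finitely many balls, on each of which the quadratic form is bounded
below by the number of visits to a set of vectors with a sizeable component along the centre. -/
lemma exists_quadratic_lower_bound [IsProbabilityMeasure P] [FiniteDimensional ℝ E]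
    [MeasurableSpace E] [BorelSpace E] {b : ℕ → Ω → E} {s : ℕ → Ω → ℝ}
    (hL : SatisfiesCountLLN P fun i ω => Real.sign (s i ω) • b i ω)
    (hnd : ∀ u : E, u ≠ 0 → 0 < P.real {ω | inner ℝ u (Real.sign (s 0 ω) • b 0 ω) ≠ 0}) :
    ∃ c > 0, ∀ a N : ℕ → ℕ, Tendsto N atTop atTop →
      Tendsto (fun n => P.real {ω | ∃ u : E, ∑ i ∈ Finset.Icc (a n + 1) (a n + N n),
        inner ℝ u (b i ω) ^ 2 < c * N n * ‖u‖ ^ 2}) atTop (𝓝 0) := by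
  have hsphere : ∃ c > 0, ∀ a N : ℕ → ℕ, Tendsto N atTop atTop →
      Tendsto (fun n => P.real {ω | ∃ u ∈ Metric.sphere (0 : E) 1,
        ∑ i ∈ Finset.Icc (a n + 1) (a n + N n), inner ℝ u (b i ω) ^ 2 < c * N n}) atTop (𝓝 0) := by
    refine (isCompact_sphere (0 : E) 1).induction_on (p := fun S => ∃ c > 0, ∀ a N : ℕ → ℕ,
      Tendsto N atTop atTop → Tendsto (fun n => P.real {ω | ∃ u ∈ S,
        ∑ i ∈ Finset.Icc (a n + 1) (a n + N n), inner ℝ u (b i ω) ^ 2 < c * N n}) atTop (𝓝 0))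
      ?_ ?_ ?_ ?_
    · exact ⟨1, one_pos, fun a N _ => by simp⟩
    · rintro S T hST ⟨c, hc, h⟩
      refine ⟨c, hc, fun a N hN => squeeze_zero (fun _ => measureReal_nonneg) (fun n => ?_)
        (h a N hN)⟩
      exact measureReal_mono fun ω ⟨u, hu, hlt⟩ => ⟨u, hST hu, hlt⟩
    · rintro S T ⟨c, hc, h⟩ ⟨c', hc', h'⟩
      refine ⟨min c c', lt_min hc hc', fun a N hN => squeeze_zero (fun _ => measureReal_nonneg)
        (fun n => ?_) (by simpa using (h a N hN).add (h' a N hN))⟩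
      refine (measureReal_mono ?_).trans (measureReal_union_le _ _)
      rintro ω ⟨u, hu | hu, hlt⟩
      · exact Or.inl ⟨u, hu, hlt.trans_le (by gcongr; exact min_le_left _ _)⟩
      · exact Or.inr ⟨u, hu, hlt.trans_le (by gcongr; exact min_le_right _ _)⟩
    · intro u₀ hu₀
      have hne : u₀ ≠ 0 := by rintro rfl; simp at hu₀
      obtain ⟨η, R, hη, hR, hpos⟩ := exists_directionSet_pos _ (hnd u₀ hne)
      refine ⟨_, mem_nhdsWithin_of_mem_nhds (Metric.ball_mem_nhds u₀ (div_pos hη hR)),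
        P.real ((fun ω => Real.sign (s 0 ω) • b 0 ω) ⁻¹' directionSet u₀ η R) / 2 * η ^ 2,
        by positivity, fun a N hN => ?_⟩
      refine squeeze_zero (fun _ => measureReal_nonneg) (fun n => ?_)
        (hL _ (measurableSet_directionSet u₀ η R) hpos a N hN)
      refine measureReal_mono ?_
      rintro ω ⟨u, hu, hlt⟩
      have hle : (∑ i ∈ Finset.Icc (a n + 1) (a n + N n), (directionSet u₀ η R).indicator
          (fun _ => (1 : ℝ)) (Real.sign (s i ω) • b i ω)) * η ^ 2 ≤
          ∑ i ∈ Finset.Icc (a n + 1) (a n + N n), inner ℝ u (b i ω) ^ 2 := by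
        rw [Finset.sum_mul]
        refine Finset.sum_le_sum fun i _ => ?_
        by_cases hi : Real.sign (s i ω) • b i ω ∈ directionSet u₀ η R
        · rw [Set.indicator_of_mem hi, one_mul, ← sq_abs (inner ℝ u (b i ω))]
          have hb := mem_directionSet_of_sign_smul_mem hη hi
          refine pow_le_pow_left₀ hη.le ?_ 2
          have h1 := abs_inner_sub_le_of_mem_directionSet hR hb hu
          have h2 := abs_sub_abs_le_abs_sub (inner ℝ u₀ (b i ω)) (inner ℝ u (b i ω))
          rw [abs_sub_comm] at h2
          linarith [hb.1]
        · rw [Set.indicator_of_notMem hi, zero_mul]; exact sq_nonneg _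
      have hη2 : 0 < η ^ 2 := by positivity
      refine le_of_mul_le_mul_right ((hle.trans hlt.le).trans (le_of_eq ?_)) hη2
      ring
  obtain ⟨c, hc, h⟩ := hsphere
  refine ⟨c, hc, fun a N hN => squeeze_zero (fun _ => measureReal_nonneg) (fun n => ?_)
    (h a N hN)⟩
  refine measureReal_mono ?_
  rintro ω ⟨u, hu⟩
  have hu0 : u ≠ 0 := by rintro rfl; simp at hu
  have hn : ‖u‖ ≠ 0 := norm_ne_zero_iff.2 hu0
  refine ⟨‖u‖⁻¹ • u, by simp [norm_smul, hn], ?_⟩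
  simp only [inner_smul_left, mul_pow, ← Finset.mul_sum]
  simp only [RCLike.conj_to_real, inv_pow]
  rw [inv_mul_lt_iff₀ (by positivity)]
  linarith

end Directions

/-! ### The increments of the moment functions near the true parameter -/

/-- A distribution function with a positive derivative at the origin charges small intervals next
to the origin proportionally to their length. -/
lemma exists_measureReal_Ioc_bounds [IsProbabilityMeasure P] {e : Ω → ℝ} (he : Measurable e)
    (hd : DifferentiableAt ℝ (cdf (P.map e)) 0) (hpos : 0 < deriv (cdf (P.map e)) 0) :
    ∃ f > 0, ∀ᶠ h in 𝓝[>] (0 : ℝ),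
      (f * h ≤ P.real (e ⁻¹' Set.Ioc 0 h) ∧ P.real (e ⁻¹' Set.Ioc 0 h) ≤ 3 * f * h) ∧
      (f * h ≤ P.real (e ⁻¹' Set.Ioc (-h) 0) ∧ P.real (e ⁻¹' Set.Ioc (-h) 0) ≤ 3 * f * h) := by
  have hprob : IsProbabilityMeasure (P.map e) := Measure.isProbabilityMeasure_map he.aemeasurable
  set F := cdf (P.map e)
  set d := deriv F 0
  have hIoc : ∀ a b : ℝ, a ≤ b → P.real (e ⁻¹' Set.Ioc a b) = F b - F a := fun a b hab => by
    rw [← map_measureReal_apply he measurableSet_Ioc, cdf_eq_real, cdf_eq_real,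
      ← Set.Iic_union_Ioc_eq_Iic hab,
      measureReal_union (Set.Iic_disjoint_Ioc le_rfl) measurableSet_Ioc, add_sub_cancel_left]
  have hlin : ∀ᶠ h in 𝓝 (0 : ℝ), |F h - F 0 - h * d| ≤ d / 2 * |h| := by
    have := (hasDerivAt_iff_isLittleO.1 hd.hasDerivAt).def (half_pos hpos)
    simpa using this
  have hlin' : ∀ᶠ h in 𝓝 (0 : ℝ), |F (-h) - F 0 - (-h) * d| ≤ d / 2 * |-h| := by
    have : Tendsto (fun h : ℝ => -h) (𝓝 0) (𝓝 0) := by simpa using (continuous_neg.tendsto (0 : ℝ))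
    exact this.eventually hlin
  refine ⟨d / 2, half_pos hpos, ?_⟩
  filter_upwards [mem_nhdsWithin_of_mem_nhds hlin, mem_nhdsWithin_of_mem_nhds hlin',
    self_mem_nhdsWithin] with h h1 h2 h0
  have h0' : (0 : ℝ) < h := h0
  rw [hIoc 0 h h0'.le, hIoc (-h) 0 (by linarith)]
  rw [abs_neg] at h2
  rw [abs_of_pos h0'] at h1 h2
  obtain ⟨h3, h4⟩ := abs_le.1 h1
  obtain ⟨h5, h6⟩ := abs_le.1 h2
  refine ⟨⟨?_, ?_⟩, ?_, ?_⟩ <;> nlinarith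

open Classical in
/-- The increment of `c * 𝕀(ε ≤ ·)` from `0` to `s`. For `c` and `s` of the same sign it is
nonnegative and monotone in `|s|`, the reason why large deviations of the parameter need no
separate treatment. -/
noncomputable def stepGain (c s ε : ℝ) : ℝ :=
  ((if ε ≤ s then 1 else 0) - (if ε ≤ 0 then 1 else 0)) * c

lemma stepGain_nonneg {c s ε : ℝ} (h : (0 ≤ c ∧ 0 ≤ s) ∨ (c ≤ 0 ∧ s ≤ 0)) :
    0 ≤ stepGain c s ε := by
  unfold stepGain
  rcases h with ⟨h1, h2⟩ | ⟨h1, h2⟩ <;> split_ifs <;> linarith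

lemma le_stepGain_of_pos {c s ε η h : ℝ} (hc : η ≤ c) (hs : h ≤ s) (hε : ε ∈ Set.Ioc 0 h) :
    η ≤ stepGain c s ε := by
  unfold stepGain
  rw [if_pos (hε.2.trans hs), if_neg (not_le.2 hε.1)]
  linarith

lemma le_stepGain_of_neg {c s ε η h : ℝ} (hc : c ≤ -η) (hs : s ≤ -h) (hε : ε ∈ Set.Ioc (-h) 0) :
    η ≤ stepGain c s ε := by
  unfold stepGain
  rw [if_neg (not_le.2 (hs.trans_lt hε.1)), if_pos hε.2]
  linarith

lemma exists_measureReal_gt_le [IsProbabilityMeasure P] {Z : Ω → ℝ} (hZ : Measurable Z) {ε : ℝ}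
    (hε : 0 < ε) : ∃ W > 0, P.real {ω | W < Z ω} ≤ ε := by
  have hprob : IsProbabilityMeasure (P.map Z) := Measure.isProbabilityMeasure_map hZ.aemeasurable
  obtain ⟨W, hW, hW0⟩ := (((tendsto_cdf_atTop (P.map Z)).eventually_const_lt
    (sub_lt_self 1 hε)).and (eventually_gt_atTop 0)).exists
  refine ⟨W, hW0, ?_⟩
  rw [cdf_eq_real, map_measureReal_apply hZ measurableSet_Iic] at hW
  have : {ω | W < Z ω} = (Z ⁻¹' Set.Iic W)ᶜ := by ext; simp
  rw [this, probReal_compl_eq_one_sub (hZ measurableSet_Iic)]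
  linarith

lemma IsCausalRegression.measureReal_count_ge_le [IsProbabilityMeasure P] {𝒳 : Type*}
    [MeasurableSpace 𝒳] {X : ℕ → Ω → 𝒳} {e : ℕ → Ω → ℝ} (h : IsCausalRegression P X e) {A : Set 𝒳}
    (hA : MeasurableSet A) (I : Finset ℕ) {δ : ℝ} (hδ : 0 < δ) :
    P.real {ω | δ ≤ ∑ i ∈ I, A.indicator (fun _ => (1 : ℝ)) (X i ω)} ≤
      I.card * P.real (X 0 ⁻¹' A) / δ := by
  have hm : MeasurableSet (X 0 ⁻¹' A) := h.measurable_regressor 0 hA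
  have hind : (fun ω => A.indicator (fun _ => (1 : ℝ)) (X 0 ω)) =
      (X 0 ⁻¹' A).indicator (fun _ => (1 : ℝ)) := rfl
  have h1 := h.measureReal_sum_ge_le (f := A.indicator fun _ => (1 : ℝ))
    (measurable_const.indicator hA) (Set.indicator_nonneg fun _ _ => zero_le_one)
    (by rw [hind]; exact (integrable_const 1).indicator hm) I hδ
  rwa [hind, integral_indicator_const _ hm, smul_eq_mul, mul_one] at h1

/-- Outside the ball of radius `C / √n` around the true parameter, the sum of the moment functions
over the first `k n` observations has moved by at least a multiple of `C * √n` towards the true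
parameter, uniformly over all directions and distances. Regressors whose weight exceeds `W` are
discarded, so that every visit to a direction set forces `|⟪u, X i⟫| ≥ η / W`; the multiple then
depends on the admitted probability `ε` through `W`, but the finite cover of the sphere does
not. -/
lemma exists_sum_stepGain_lower_bound [IsProbabilityMeasure P] {F E : Type*}
    [NormedAddCommGroup F] [InnerProductSpace ℝ F] [FiniteDimensional ℝ F] [MeasurableSpace F]
    [BorelSpace F] [NormedAddCommGroup E] [InnerProductSpace ℝ E] [MeasurableSpace E] [BorelSpace E]
    {X : ℕ → Ω → F} {e : ℕ → Ω → ℝ} (h : IsCausalRegression P X e) (ι : F →ₗᵢ[ℝ] E) {a : F → E}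
    {w : F → ℝ} (ha : Measurable a) (hw : Measurable w) (hwpos : ∀ x, 0 < w x)
    (hι : ∀ u x, inner ℝ (ι u) (a x) = w x * inner ℝ u x)
    (hL : SatisfiesCountLLN P fun i ω => Real.sign (e i ω) • a (X i ω))
    (hnd : ∀ u : E, u ≠ 0 → 0 < P.real {ω | inner ℝ u (Real.sign (e 0 ω) • a (X 0 ω)) ≠ 0})
    (hd : DifferentiableAt ℝ (cdf (P.map (e 0))) 0) (hpos : 0 < deriv (cdf (P.map (e 0))) 0)
    {k : ℕ → ℕ} {ρ : ℝ} (hρ : 0 < ρ) (hk : ∀ᶠ n : ℕ in atTop, ρ * (n : ℝ) ≤ k n)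
    {ε : ℝ} (hε : 0 < ε) :
    ∃ κ > 0, ∀ C > 0, ∀ᶠ n : ℕ in atTop, P.real {ω | ∃ u ∈ Metric.sphere (0 : F) 1,
      ∃ t ≥ C / √(n : ℝ), ∑ i ∈ Finset.Icc 1 (k n), stepGain (inner ℝ (ι u) (a (X i ω)))
        (t * inner ℝ u (X i ω)) (e i ω) < κ * C * √(n : ℝ)} ≤ ε := by
  revert ε
  change ∀ {ε : ℝ}, 0 < ε → _
  refine (isCompact_sphere (0 : F) 1).induction_on (p := fun S => ∀ {ε : ℝ}, 0 < ε →
    ∃ κ > 0, ∀ C > 0, ∀ᶠ n : ℕ in atTop, P.real {ω | ∃ u ∈ S,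
      ∃ t ≥ C / √(n : ℝ), ∑ i ∈ Finset.Icc 1 (k n), stepGain (inner ℝ (ι u) (a (X i ω)))
        (t * inner ℝ u (X i ω)) (e i ω) < κ * C * √(n : ℝ)} ≤ ε) ?_ ?_ ?_ ?_
  · intro ε hε
    exact ⟨1, one_pos, fun C _ => Eventually.of_forall fun n => by simpa using hε.le⟩
  · intro S T hST hT ε hε
    obtain ⟨κ, hκ, hC⟩ := hT hε
    refine ⟨κ, hκ, fun C hC0 => (hC C hC0).mono fun n hn => (measureReal_mono ?_).trans hn⟩
    rintro ω ⟨u, hu, hlt⟩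
    exact ⟨u, hST hu, hlt⟩
  · intro S T hS hT ε hε
    obtain ⟨κ, hκ, hC⟩ := hS (half_pos hε)
    obtain ⟨κ', hκ', hC'⟩ := hT (half_pos hε)
    refine ⟨min κ κ', lt_min hκ hκ', fun C hC0 => ?_⟩
    filter_upwards [hC C hC0, hC' C hC0] with n hn hn'
    refine ((measureReal_mono ?_).trans (measureReal_union_le _ _)).trans
      ((add_le_add hn hn').trans (add_halves ε).le)
    rintro ω ⟨u, hu | hu, t, ht, hlt⟩
    · exact Or.inl ⟨u, hu, t, ht, hlt.trans_le (by gcongr; exact min_le_left _ _)⟩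
    · exact Or.inr ⟨u, hu, t, ht, hlt.trans_le (by gcongr; exact min_le_right _ _)⟩
  intro u₀ hu₀
  have hne : ι u₀ ≠ 0 := by
    intro h0
    rw [map_eq_zero_iff _ ι.injective] at h0
    rw [h0] at hu₀; simp at hu₀
  obtain ⟨η, R, hη, hR, hπ⟩ := exists_directionSet_pos _ (hnd (ι u₀) hne)
  set D := directionSet (ι u₀) η R with hDdef
  have hD : MeasurableSet D := measurableSet_directionSet _ _ _
  set π := P.real ((fun ω => Real.sign (e 0 ω) • a (X 0 ω)) ⁻¹' D)
  refine ⟨_, mem_nhdsWithin_of_mem_nhds (Metric.ball_mem_nhds u₀ (div_pos hη hR)), ?_⟩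
  intro ε hε
  obtain ⟨W, hW, hWε⟩ := exists_measureReal_gt_le (P := P) (hw.comp (h.measurable_regressor 0))
    (by positivity : 0 < ε * π / 16)
  obtain ⟨f, hf, hfI⟩ := exists_measureReal_Ioc_bounds (h.measurable_error 0) hd hpos
  -- the regressors counted in the direction `u₀` and in the opposite one
  let Ap : Set F := {x | a x ∈ D ∧ 0 < inner ℝ (ι u₀) (a x) ∧ w x ≤ W}
  let Am : Set F := {x | a x ∈ D ∧ inner ℝ (ι u₀) (a x) < 0 ∧ w x ≤ W}
  let Bad : Set F := {x | W < w x}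
  have hin : Measurable fun x => (inner ℝ (ι u₀) (a x) : ℝ) :=
    (by fun_prop : Continuous fun z : E => (inner ℝ (ι u₀) z : ℝ)).measurable.comp ha
  have hAp : MeasurableSet Ap := (ha hD).inter
    ((measurableSet_lt measurable_const hin).inter (measurableSet_le hw measurable_const))
  have hAm : MeasurableSet Am := (ha hD).inter
    ((measurableSet_lt hin measurable_const).inter (measurableSet_le hw measurable_const))
  have hBad : MeasurableSet Bad := measurableSet_lt measurable_const hw
  refine ⟨η * (π / 8) * (ρ * f * η / W), by positivity, fun C hC => ?_⟩
  have hsqrt : Tendsto (fun n : ℕ => √(n : ℝ)) atTop atTop :=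
    Real.tendsto_sqrt_atTop.comp tendsto_natCast_atTop_atTop
  have hh : Tendsto (fun n : ℕ => C / √(n : ℝ) * (η / W)) atTop (𝓝[>] 0) := by
    refine tendsto_nhdsWithin_iff.2 ⟨?_, ?_⟩
    · simpa using (hsqrt.const_div_atTop C).mul_const (η / W)
    · filter_upwards [eventually_gt_atTop 0] with n hn
      have : (0 : ℝ) < n := by exact_mod_cast hn
      exact Set.mem_Ioi.2 (by positivity)
  have hkt : Tendsto k atTop atTop := by
    refine tendsto_natCast_atTop_iff.1 (tendsto_atTop_mono' _ hk ?_ :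
      Tendsto (fun n => (k n : ℝ)) atTop atTop)
    exact tendsto_natCast_atTop_atTop.const_mul_atTop hρ
  have hcount := (hL D hD hπ (fun _ => 0) k hkt).eventually_le_const
    (by positivity : (0 : ℝ) < ε / 4)
  have hvar : ∀ᶠ n : ℕ in atTop, 768 / (π ^ 2 * ((ρ * f * C * η / W) * √(n : ℝ))) ≤ ε / 4 := by
    have : Tendsto (fun n : ℕ => 768 / (π ^ 2 * ((ρ * f * C * η / W) * √(n : ℝ)))) atTop (𝓝 0) := by
      refine Tendsto.const_div_atTop ?_ _
      refine Tendsto.const_mul_atTop (by positivity) ?_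
      exact hsqrt.const_mul_atTop (by positivity)
    exact this.eventually_le_const (by positivity)
  filter_upwards [hcount, hvar, hk, hh.eventually hfI, eventually_gt_atTop 0] with n hn1 hn2 hn3
    hn4 hn0
  have hnR : (0 : ℝ) < n := by exact_mod_cast hn0
  have hs : 0 < √(n : ℝ) := Real.sqrt_pos.2 hnR
  have hss : √(n : ℝ) * √(n : ℝ) = n := Real.mul_self_sqrt hnR.le
  set s := √(n : ℝ)
  -- the arguments of the step functions have at least this distance from the origin
  set η' := C / s * (η / W) with hη'
  have hη'0 : 0 < η' := by positivity
  obtain ⟨⟨hp1, hp2⟩, hm1, hm2⟩ := hn4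
  set pp := P.real (e 0 ⁻¹' Set.Ioc 0 η')
  set pm := P.real (e 0 ⁻¹' Set.Ioc (-η') 0)
  set K : ℝ := (k n : ℝ)
  have hK : 0 < K := lt_of_lt_of_le (by positivity) hn3
  have hKp : (ρ * f * C * η / W) * s ≤ K * (f * η') := by
    calc (ρ * f * C * η / W) * s = (ρ * n) * (f * η') := by
          rw [hη', ← hss]; field_simp
      _ ≤ _ := by gcongr
  have hcardI : ((Finset.Icc 1 (k n)).card : ℝ) = K := by simp [K]
  -- an eighth of the expected count, which is bounded below by `π / 2 * K * (f * η')`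
  set δ := π / 16 * (K * (f * η')) with hδ
  have hδ0 : 0 < δ := by positivity
  have hvarle : ∀ x, x ≤ 3 * f * η' → K * x / δ ^ 2 ≤ ε / 4 := fun x hx => by
    refine le_trans ?_ hn2
    calc K * x / δ ^ 2 ≤ K * (3 * f * η') / δ ^ 2 := by gcongr
      _ = 768 / (π ^ 2 * (K * (f * η'))) := by rw [hδ]; field_simp; norm_num
      _ ≤ _ := by gcongr
  have hE2 := h.measureReal_count_ge_le hBad (Finset.Icc 1 (k n))
    (by positivity : 0 < π / 4 * K)
  rw [hcardI] at hE2
  have hE2' : K * P.real (X 0 ⁻¹' Bad) / (π / 4 * K) ≤ ε / 4 := by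
    rw [div_le_iff₀ (by positivity)]
    have : P.real (X 0 ⁻¹' Bad) ≤ ε * π / 16 := hWε
    nlinarith
  have hE3 := h.measureReal_count_dev_le hAp (measurableSet_Ioc (a := 0) (b := η'))
    (Finset.Icc 1 (k n)) hδ0
  have hE4 := h.measureReal_count_dev_le hAm (measurableSet_Ioc (a := -η') (b := 0))
    (Finset.Icc 1 (k n)) hδ0
  rw [hcardI] at hE3 hE4
  have hE3' := hE3.trans (hvarle _ hp2)
  have hE4' := hE4.trans (hvarle _ hm2)
  simp only [zero_add] at hn1
  have hsub : {ω | ∃ u ∈ Metric.ball u₀ (η / R),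
      ∃ t ≥ C / s, ∑ i ∈ Finset.Icc 1 (k n), stepGain (inner ℝ (ι u) (a (X i ω)))
        (t * inner ℝ u (X i ω)) (e i ω) < η * (π / 8) * (ρ * f * η / W) * C * s} ⊆
      ({ω | ∑ i ∈ Finset.Icc 1 (k n), D.indicator (fun _ => (1 : ℝ))
          (Real.sign (e i ω) • a (X i ω)) ≤ π / 2 * K} ∪
        {ω | π / 4 * K ≤ ∑ i ∈ Finset.Icc 1 (k n), Bad.indicator (fun _ => (1 : ℝ)) (X i ω)}) ∪
      ({ω | δ ≤ |∑ i ∈ Finset.Icc 1 (k n), Ap.indicator (fun _ => (1 : ℝ)) (X i ω) *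
        ((Set.Ioc 0 η').indicator (fun _ => (1 : ℝ)) (e i ω) - pp)|} ∪
      {ω | δ ≤ |∑ i ∈ Finset.Icc 1 (k n), Am.indicator (fun _ => (1 : ℝ)) (X i ω) *
        ((Set.Ioc (-η') 0).indicator (fun _ => (1 : ℝ)) (e i ω) - pm)|}) := by
    rintro ω ⟨u, hu, t, ht, hlt⟩
    by_contra hcon
    simp only [Set.mem_union, Set.mem_ofPred_eq, not_or, not_le] at hcon
    obtain ⟨⟨h1, h2⟩, h3, h4⟩ := hcon
    have hιu : ι u ∈ Metric.ball (ι u₀) (η / R) := by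
      rwa [Metric.mem_ball, ι.dist_map]
    have ht0 : 0 < t := lt_of_lt_of_le (by positivity) ht
    -- the direction sets force a sizeable regressor in the direction `u`
    have hlow : ∀ x, w x ≤ W → η ≤ w x * |inner ℝ u x| → η' ≤ t * |inner ℝ u x| := by
      intro x hx hx'
      have : η / W ≤ |inner ℝ u x| := by
        rw [div_le_iff₀ hW]
        calc η ≤ w x * |inner ℝ u x| := hx'
          _ ≤ W * |inner ℝ u x| := by gcongr
          _ = _ := mul_comm _ _
      exact mul_le_mul ht this (by positivity) ht0.le
    -- each counted error contributes at least `η`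
    have hgain : ∀ i, η * (Ap.indicator (fun _ => (1 : ℝ)) (X i ω) *
          (Set.Ioc 0 η').indicator (fun _ => (1 : ℝ)) (e i ω) +
        Am.indicator (fun _ => (1 : ℝ)) (X i ω) *
          (Set.Ioc (-η') 0).indicator (fun _ => (1 : ℝ)) (e i ω)) ≤
        stepGain (inner ℝ (ι u) (a (X i ω))) (t * inner ℝ u (X i ω)) (e i ω) := fun i => by
      set x := X i ω
      have hnn : 0 ≤ stepGain (inner ℝ (ι u) (a x)) (t * inner ℝ u x) (e i ω) := by
        apply stepGain_nonneg
        rw [hι]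
        rcases le_total 0 (inner ℝ u x : ℝ) with h0 | h0
        · exact Or.inl ⟨mul_nonneg (hwpos x).le h0, mul_nonneg ht0.le h0⟩
        · exact Or.inr ⟨mul_nonpos_of_nonneg_of_nonpos (hwpos x).le h0,
            mul_nonpos_of_nonneg_of_nonpos ht0.le h0⟩
      by_cases hxp : x ∈ Ap
      · have hxm : x ∉ Am := fun hxm => lt_asymm hxp.2.1 hxm.2.1
        rw [Set.indicator_of_mem hxp, Set.indicator_of_notMem hxm, zero_mul, add_zero, one_mul]
        by_cases he : e i ω ∈ Set.Ioc 0 η'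
        · rw [Set.indicator_of_mem he, mul_one]
          have h5 := hxp.1.1
          rw [abs_of_pos hxp.2.1] at h5
          have h6 := (abs_le.1 (abs_inner_sub_le_of_mem_directionSet hR hxp.1 hιu)).1
          have h7 : η ≤ inner ℝ (ι u) (a x) := by linarith
          have h8 : 0 < (inner ℝ u x : ℝ) := by
            rw [hι] at h7
            exact (pos_iff_pos_of_mul_pos (hη.trans_le h7)).1 (hwpos x)
          refine le_stepGain_of_pos h7 ?_ he
          have := hlow x hxp.2.2 (by rw [abs_of_pos h8, ← hι]; exact h7)
          rwa [abs_of_pos h8] at this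
        · rw [Set.indicator_of_notMem he, mul_zero]; exact hnn
      · rw [Set.indicator_of_notMem hxp, zero_mul, zero_add]
        by_cases hxm : x ∈ Am
        · rw [Set.indicator_of_mem hxm, one_mul]
          by_cases he : e i ω ∈ Set.Ioc (-η') 0
          · rw [Set.indicator_of_mem he, mul_one]
            have h5 := hxm.1.1
            rw [abs_of_neg hxm.2.1] at h5
            have h6 := (abs_le.1 (abs_inner_sub_le_of_mem_directionSet hR hxm.1 hιu)).2
            have h7 : inner ℝ (ι u) (a x) ≤ -η := by linarith
            have h8 : (inner ℝ u x : ℝ) < 0 := by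
              rw [hι] at h7
              by_contra! h9
              have := mul_nonneg (hwpos x).le h9
              linarith
            refine le_stepGain_of_neg h7 ?_ he
            have := hlow x hxm.2.2 (by rw [abs_of_neg h8, mul_neg, ← hι]; linarith)
            rw [abs_of_neg h8] at this
            linarith
          · rw [Set.indicator_of_notMem he, mul_zero]; exact hnn
        · rw [Set.indicator_of_notMem hxm, zero_mul, mul_zero]; exact hnn
    have hcov : ∀ i, D.indicator (fun _ => (1 : ℝ)) (Real.sign (e i ω) • a (X i ω)) ≤
        Ap.indicator (fun _ => (1 : ℝ)) (X i ω) + Am.indicator (fun _ => (1 : ℝ)) (X i ω) +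
          Bad.indicator (fun _ => (1 : ℝ)) (X i ω) := fun i => by
      set x := X i ω
      have hnn : ∀ A : Set F, 0 ≤ A.indicator (fun _ => (1 : ℝ)) x := fun A =>
        Set.indicator_nonneg (fun _ _ => zero_le_one) _
      by_cases hx : Real.sign (e i ω) • a x ∈ D
      · rw [Set.indicator_of_mem hx]
        have hax : a x ∈ D := mem_directionSet_of_sign_smul_mem hη hx
        have hax0 : (inner ℝ (ι u₀) (a x) : ℝ) ≠ 0 := by
          intro h0
          have := hax.1
          rw [h0, abs_zero] at this
          linarith
        by_cases hb : w x ≤ W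
        · rcases lt_or_gt_of_ne hax0 with h0 | h0
          · have : x ∈ Am := ⟨hax, h0, hb⟩
            rw [Set.indicator_of_mem this]
            linarith [hnn Ap, hnn Bad]
          · have : x ∈ Ap := ⟨hax, h0, hb⟩
            rw [Set.indicator_of_mem this]
            linarith [hnn Am, hnn Bad]
        · have : x ∈ Bad := not_le.1 hb
          rw [Set.indicator_of_mem this]
          linarith [hnn Am, hnn Ap]
      · rw [Set.indicator_of_notMem hx]
        linarith [hnn Am, hnn Ap, hnn Bad]
    have hsumcov := Finset.sum_le_sum fun i (_ : i ∈ Finset.Icc 1 (k n)) => hcov i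
    have hsumgain := Finset.sum_le_sum fun i (_ : i ∈ Finset.Icc 1 (k n)) => hgain i
    rw [← Finset.mul_sum, Finset.sum_add_distrib] at hsumgain
    simp only [Finset.sum_add_distrib] at hsumcov
    simp only [mul_sub, Finset.sum_sub_distrib, ← Finset.sum_mul] at h3 h4
    set Np := ∑ i ∈ Finset.Icc 1 (k n), Ap.indicator (fun _ => (1 : ℝ)) (X i ω)
    set Nm := ∑ i ∈ Finset.Icc 1 (k n), Am.indicator (fun _ => (1 : ℝ)) (X i ω)
    have hNp : 0 ≤ Np := Finset.sum_nonneg fun i _ =>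
      Set.indicator_nonneg (fun _ _ => zero_le_one) _
    have hNm : 0 ≤ Nm := Finset.sum_nonneg fun i _ =>
      Set.indicator_nonneg (fun _ _ => zero_le_one) _
    have h5 := (abs_lt.1 h3).1
    have h6 := (abs_lt.1 h4).1
    have h7 : f * η' * Np ≤ Np * pp := by rw [mul_comm]; gcongr
    have h8 : f * η' * Nm ≤ Nm * pm := by rw [mul_comm]; gcongr
    have h9 : f * η' * (π / 4 * K) ≤ f * η' * (Np + Nm) := by gcongr; linarith
    have h11 : η * (π / 8 * (K * (f * η'))) < η * (π / 8) * (ρ * f * η / W) * C * s := by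
      refine lt_of_le_of_lt (mul_le_mul_of_nonneg_left ?_ hη.le) (hsumgain.trans_lt hlt)
      rw [hδ] at h5 h6
      linarith
    have h12 : η * (π / 8) * (ρ * f * η / W) * C * s ≤ η * (π / 8 * (K * (f * η'))) := by
      calc _ = η * (π / 8 * ((ρ * f * C * η / W) * s)) := by ring
        _ ≤ _ := by gcongr
    exact absurd h11 (not_lt.2 h12)
  refine (measureReal_mono hsub).trans ((measureReal_union_le _ _).trans ?_)
  have hu1 := measureReal_union_le (μ := P) {ω | ∑ i ∈ Finset.Icc 1 (k n), D.indicator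
    (fun _ => (1 : ℝ)) (Real.sign (e i ω) • a (X i ω)) ≤ π / 2 * K}
    {ω | π / 4 * K ≤ ∑ i ∈ Finset.Icc 1 (k n), Bad.indicator (fun _ => (1 : ℝ)) (X i ω)}
  refine (add_le_add hu1 (measureReal_union_le _ _)).trans ?_
  linarith [hE2.trans hE2']

/-! ### Moment bounds for the moment functions at the true parameter -/

namespace IsCausalRegression

lemma measureReal_norm_sum_ge_le [IsProbabilityMeasure P] {𝒳 κ : Type*} [MeasurableSpace 𝒳]
    [Fintype κ] {X : ℕ → Ω → 𝒳} {e : ℕ → Ω → ℝ} (h : IsCausalRegression P X e)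
    {a : 𝒳 → EuclideanSpace ℝ κ} {ξ : ℝ → ℝ} (ha : Measurable a) (hξ : Measurable ξ)
    (hξ1 : ∀ x, |ξ x| ≤ 1) (ha2 : Integrable (fun ω => ‖a (X 0 ω)‖ ^ 2) P)
    (hξ0 : ∫ ω, ξ (e 0 ω) ∂P = 0) (I : Finset ℕ) {δ : ℝ} (hδ : 0 < δ) :
    P.real {ω | δ ≤ ‖∑ i ∈ I, ξ (e i ω) • a (X i ω)‖} ≤
      I.card * (∫ ω, ‖a (X 0 ω)‖ ^ 2 ∂P) / δ ^ 2 := by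
  have hcoord : ∀ j, Measurable fun x => a x j := fun j =>
    (by fun_prop : Continuous fun z : EuclideanSpace ℝ κ => z j).measurable.comp ha
  have hnorm : ∀ z : EuclideanSpace ℝ κ, ‖z‖ ^ 2 = ∑ j, z j ^ 2 := fun z => by
    rw [EuclideanSpace.norm_sq_eq]; simp
  have hj2 : ∀ j, Integrable (fun ω => a (X 0 ω) j ^ 2) P := fun j => by
    refine ha2.mono (((hcoord j).comp (h.measurable_regressor 0)).pow_const 2).aestronglyMeasurable
      (ae_of_all _ fun ω => ?_)
    rw [Real.norm_of_nonneg (sq_nonneg _), Real.norm_of_nonneg (sq_nonneg _), hnorm]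
    exact Finset.single_le_sum (f := fun j => a (X 0 ω) j ^ 2) (fun _ _ => sq_nonneg _)
      (Finset.mem_univ j)
  have hsq : ∀ ω, ‖∑ i ∈ I, ξ (e i ω) • a (X i ω)‖ ^ 2 =
      ∑ j, (∑ i ∈ I, a (X i ω) j * ξ (e i ω)) ^ 2 := fun ω => by
    rw [hnorm]
    refine Finset.sum_congr rfl fun j _ => ?_
    congr 1
    simp [mul_comm]
  have hm := fun j => h.integral_sum_sq (hcoord j) hξ hξ1 (hj2 j) hξ0 I
  have hint : Integrable (fun ω => ‖∑ i ∈ I, ξ (e i ω) • a (X i ω)‖ ^ 2) P := by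
    simp only [hsq]
    exact integrable_finsetSum _ fun j _ => (hm j).1
  have hξ2 : ∫ ω, ξ (e 0 ω) ^ 2 ∂P ≤ 1 := by
    have hb : ∀ ω, ξ (e 0 ω) ^ 2 ≤ 1 := fun ω => by
      rw [← sq_abs]; exact pow_le_one₀ (abs_nonneg _) (hξ1 _)
    refine (integral_mono_of_nonneg (ae_of_all _ fun ω => sq_nonneg _) (integrable_const 1)
      (ae_of_all _ hb)).trans ?_
    simp
  have hcheb := measureReal_abs_ge_le hint hδ
  simp only [abs_norm] at hcheb
  refine hcheb.trans ?_
  gcongr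
  simp only [hsq]
  rw [integral_finsetSum _ fun j _ => (hm j).1]
  simp only [hnorm]
  rw [integral_finsetSum _ fun j _ => hj2 j, Finset.mul_sum]
  refine Finset.sum_le_sum fun j _ => ?_
  rw [(hm j).2]
  gcongr
  exact mul_le_of_le_one_right (integral_nonneg fun ω => sq_nonneg _) hξ2

/-- With a moment of order larger than two, the largest of `n` terms is of smaller order than
`√n`. -/
lemma tendsto_measureReal_exists_gt [IsProbabilityMeasure P] {𝒳 : Type*} [MeasurableSpace 𝒳]
    {X : ℕ → Ω → 𝒳} {e : ℕ → Ω → ℝ} (h : IsCausalRegression P X e) {f : 𝒳 → ℝ}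
    (hf : Measurable f) (hf0 : ∀ x, 0 ≤ f x) {γ : ℝ} (hγ : 2 < γ)
    (hfi : Integrable (fun ω => f (X 0 ω) ^ γ) P) {δ : ℝ} (hδ : 0 < δ) :
    Tendsto (fun n : ℕ => P.real {ω | ∃ i ∈ Finset.Icc 1 n, δ * √(n : ℝ) < f (X i ω)}) atTop
      (𝓝 0) := by
  have hγ0 : 0 < γ := by linarith
  set m := ∫ ω, f (X 0 ω) ^ γ ∂P
  have hlim : Tendsto (fun n : ℕ => m / δ ^ γ * (n : ℝ) ^ (-(γ / 2 - 1))) atTop (𝓝 0) := by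
    have := ((tendsto_rpow_neg_atTop (by linarith : 0 < γ / 2 - 1)).comp
      tendsto_natCast_atTop_atTop).const_mul (m / δ ^ γ)
    simpa using this
  refine squeeze_zero' (Eventually.of_forall fun _ => measureReal_nonneg) ?_ hlim
  filter_upwards [eventually_gt_atTop 0] with n hn
  have hn' : (0 : ℝ) < n := by exact_mod_cast hn
  have hs : 0 < δ * √(n : ℝ) := by positivity
  have h1 := h.measureReal_sum_ge_le (f := fun x => f x ^ γ) (hf.pow_const γ)
    (fun x => Real.rpow_nonneg (hf0 x) γ) hfi (Finset.Icc 1 n) (Real.rpow_pos_of_pos hs γ)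
  refine (measureReal_mono ?_).trans (h1.trans (le_of_eq ?_))
  · rintro ω ⟨i, hi, hlt⟩
    exact (Real.rpow_le_rpow hs.le hlt.le hγ0.le).trans (Finset.single_le_sum
      (f := fun i => f (X i ω) ^ γ) (fun i _ => Real.rpow_nonneg (hf0 _) γ) hi)
  · rw [Real.mul_rpow hδ.le (Real.sqrt_nonneg _), Real.sqrt_eq_rpow, ← Real.rpow_mul hn'.le,
      neg_sub, Real.rpow_sub hn', Real.rpow_one]
    simp only [Nat.card_Icc, Nat.add_sub_cancel]
    rw [show 1 / 2 * γ = γ / 2 by ring]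
    change (n : ℝ) * m / _ = _
    field_simp

end IsCausalRegression

/-! ### The autoregression as a causal regression -/

lemma measurable_lagVec (p : ℕ) (t : ℤ) : Measurable fun y : ℤ → ℝ => lagVec p y t :=
  (WithLp.measurable_toLp 2 _).comp (measurable_pi_lambda _ fun _ => measurable_pi_apply _)

lemma measurable_aStar {p q : ℕ} {w : EuclideanSpace ℝ (Fin p) → ℝ}
    {φ : EuclideanSpace ℝ (Fin p) → EuclideanSpace ℝ (Fin q)} (hw : Measurable w)
    (hφ : Measurable φ) : Measurable (aStar w φ) := by
  refine hw.smul ((WithLp.measurable_toLp 2 _).comp (measurable_pi_lambda _ ?_))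
  rintro (i | j)
  · exact (by fun_prop : Continuous fun x : EuclideanSpace ℝ (Fin p) => x i).measurable
  · exact (by fun_prop : Continuous fun x : EuclideanSpace ℝ (Fin q) => x j).measurable.comp hφ

/-- The inclusion of the regressor space as the first block of the space of the moment
functions. -/
noncomputable def firstBlock (p q : ℕ) :
    EuclideanSpace ℝ (Fin p) →ₗᵢ[ℝ] EuclideanSpace ℝ (Fin p ⊕ Fin q) where
  toFun u := WithLp.toLp 2 (Sum.elim (fun i => u i) fun _ => 0)
  map_add' u u' := by ext (i | j) <;> simp
  map_smul' r u := by ext (i | j) <;> simp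
  norm_map' u := by simp [EuclideanSpace.norm_eq]

lemma inner_firstBlock_aStar {p q : ℕ} (w : EuclideanSpace ℝ (Fin p) → ℝ)
    (φ : EuclideanSpace ℝ (Fin p) → EuclideanSpace ℝ (Fin q)) (u x : EuclideanSpace ℝ (Fin p)) :
    inner ℝ (firstBlock p q u) (aStar w φ x) = w x * inner ℝ u x := by
  rw [aStar, inner_smul_right, PiLp.inner_apply, PiLp.inner_apply, Fintype.sum_sum_type]
  simp [firstBlock, aFun]

lemma isCausalRegression_lagVec [IsProbabilityMeasure P] {p : ℕ} [NeZero p]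
    {β : EuclideanSpace ℝ (Fin p)}
    (hroots : ∀ z : ℂ, ‖z‖ ≤ 1 → 1 - ∑ i : Fin p, ((β i : ℝ) : ℂ) * z ^ ((i : ℕ) + 1) ≠ 0)
    {e y : ℤ → Ω → ℝ} (he : ∀ t, Measurable (e t)) (hy : ∀ t, Measurable (y t))
    (hindep : iIndepFun e P) (hident : ∀ s t, IdentDistrib (e s) (e t) P P)
    (hstat : IsStrictlyStationary P y)
    (hAR : ∀ (t : ℤ) (ω : Ω),
      y t ω = inner ℝ (lagVec p (fun s => y s ω) (t - 1)) β + e t ω) :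
    IsCausalRegression P (fun (i : ℕ) ω => lagVec p (fun s => y s ω) ((i : ℤ) - 1))
      (fun (i : ℕ) => e i) := by
  have hpast := indepFun_past hroots he hy hindep hstat hAR
  -- lag vectors and errors as functions of the path before time `t`
  let lagPast : (t i : ℤ) → i ≤ t → (Set.Iio t → ℝ) → EuclideanSpace ℝ (Fin p) :=
    fun t i hi z => WithLp.toLp 2 fun j => z ⟨i - 1 - (j : ℤ), by simp only [Set.mem_Iio]; omega⟩
  have hlag : ∀ t i hi, Measurable (lagPast t i hi) := fun t i hi =>
    (WithLp.measurable_toLp 2 _).comp (measurable_pi_lambda _ fun _ => measurable_pi_apply _)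
  refine ⟨fun i => (measurable_lagVec p _).comp (measurable_pi_lambda _ hy), fun i => he i,
    fun i => ?_, fun i => hident _ _, fun i => ?_, fun i j hij => ?_⟩
  · have := hstat.identDistrib hy (measurable_lagVec p (-1)) i
    have h0 : (fun ω => lagVec p (fun s => y (s + i) ω) (-1)) =
        fun ω => lagVec p (fun s => y s ω) ((i : ℤ) - 1) := by
      ext ω j
      simp only [lagVec]
      congr 1; ring
    rw [h0] at this
    simpa using this
  · exact (hpast i).comp (hlag i i le_rfl) measurable_id
  · have hij' : (i : ℤ) < j := by exact_mod_cast hij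
    have h1 : (fun ω => (lagVec p (fun s => y s ω) ((i : ℤ) - 1), e i ω,
        lagVec p (fun s => y s ω) ((j : ℤ) - 1))) =
        (fun z : Set.Iio (j : ℤ) → ℝ => (lagPast j i hij'.le z,
          z ⟨i, hij'⟩ - inner ℝ (lagPast j i hij'.le z) β, lagPast j j le_rfl z)) ∘
        fun ω (s : Set.Iio (j : ℤ)) => y s ω := by
      ext1 ω
      have h2 : e i ω = y i ω - inner ℝ (lagVec p (fun s => y s ω) ((i : ℤ) - 1)) β := by
        rw [hAR i ω]; ring
      rw [h2]
      rfl
    have h3 : Measurable fun z : Set.Iio (j : ℤ) → ℝ => (lagPast j i hij'.le z,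
        z ⟨i, hij'⟩ - inner ℝ (lagPast j i hij'.le z) β, lagPast j j le_rfl z) := by
      refine (hlag _ _ hij'.le).prodMk (((measurable_pi_apply _).sub ?_).prodMk
        (hlag _ _ le_rfl))
      exact (by fun_prop : Continuous fun x : EuclideanSpace ℝ (Fin p) =>
        (inner ℝ x β : ℝ)).measurable.comp (hlag _ _ hij'.le)
    rw [h1]
    exact (hpast j).comp h3 measurable_id

lemma measurable_real_sign : Measurable Real.sign := by
  have : Real.sign = fun x => if x < 0 then (-1 : ℝ) else if 0 < x then 1 else 0 := rfl
  rw [this]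
  exact Measurable.ite measurableSet_Iio measurable_const
    (Measurable.ite measurableSet_Ioi measurable_const measurable_const)

lemma satisfiesCountLLN_sign_smul [IsProbabilityMeasure P] {p : ℕ} {E : Type*}
    [NormedAddCommGroup E] [NormedSpace ℝ E] [MeasurableSpace E] [BorelSpace E]
    [SecondCountableTopology E]
    {β : EuclideanSpace ℝ (Fin p)} {e y : ℤ → Ω → ℝ} (hy : ∀ t, Measurable (y t))
    (hstat : IsStrictlyStationary P y)
    (hAR : ∀ (t : ℤ) (ω : Ω),
      y t ω = inner ℝ (lagVec p (fun s => y s ω) (t - 1)) β + e t ω)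
    {a : EuclideanSpace ℝ (Fin p) → E} (ha : Measurable a)
    (hmixing : IsStrongMixing P (fun (t : ℤ) ω =>
      Real.sign (e t ω) • a (lagVec p (fun s => y s ω) (t - 1)))) :
    SatisfiesCountLLN P fun (i : ℕ) ω =>
      Real.sign (e i ω) • a (lagVec p (fun s => y s ω) ((i : ℤ) - 1)) := by
  let G : (ℤ → ℝ) → E := fun z =>
    Real.sign (z 0 - inner ℝ (lagVec p z (-1)) β) • a (lagVec p z (-1))
  have hG : Measurable G := by
    refine Measurable.smul (measurable_real_sign.comp ((measurable_pi_apply _).sub ?_))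
      (ha.comp (measurable_lagVec p _))
    exact (by fun_prop : Continuous fun x : EuclideanSpace ℝ (Fin p) =>
      (inner ℝ x β : ℝ)).measurable.comp (measurable_lagVec p _)
  have hv : ∀ t : ℤ, (fun ω => Real.sign (e t ω) • a (lagVec p (fun s => y s ω) (t - 1))) =
      fun ω => G fun s => y (s + t) ω := fun t => by
    ext1 ω
    have h1 : e t ω = y t ω - inner ℝ (lagVec p (fun s => y s ω) (t - 1)) β := by
      rw [hAR t ω]; ring
    have h2 : lagVec p (fun s => y (s + t) ω) (-1) = lagVec p (fun s => y s ω) (t - 1) := by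
      ext j; simp only [lagVec]; congr 1; ring
    simp only [G, h1, h2, zero_add]
  have hm : ∀ t : ℤ, Measurable fun ω =>
      Real.sign (e t ω) • a (lagVec p (fun s => y s ω) (t - 1)) := fun t => by
    rw [hv]; exact hG.comp (measurable_pi_lambda _ fun s => hy (s + t))
  have hid : ∀ t : ℤ, IdentDistrib
      (fun ω => Real.sign (e t ω) • a (lagVec p (fun s => y s ω) (t - 1)))
      (fun ω => Real.sign (e 0 ω) • a (lagVec p (fun s => y s ω) (0 - 1))) P P := fun t => by
    rw [hv, hv]
    simpa using hstat.identDistrib hy hG t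
  intro D hD hpos b N hN
  refine tendsto_measureReal_count_le hm hmixing hD hpos (fun t => ?_) b N hN
  rw [measureReal_def, measureReal_def, (hid t).measure_mem_eq hD]
  rfl

/-! ### The median and the nondegeneracy of the moment functions -/

lemma measureReal_zero_fiber [IsProbabilityMeasure P] {e : Ω → ℝ} (he : Measurable e)
    (hd : DifferentiableAt ℝ (cdf (P.map e)) 0) (hpos : 0 < deriv (cdf (P.map e)) 0) :
    P.real {ω | e ω = 0} = 0 := by
  obtain ⟨f, hf, hfI⟩ := exists_measureReal_Ioc_bounds he hd hpos
  have hlim : Tendsto (fun h : ℝ => 3 * f * h) (𝓝[>] 0) (𝓝 0) := by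
    have : Tendsto (fun h : ℝ => 3 * f * h) (𝓝 0) (𝓝 0) := by
      simpa using (continuous_const_mul (3 * f)).tendsto (0 : ℝ)
    exact this.mono_left nhdsWithin_le_nhds
  refine le_antisymm (ge_of_tendsto hlim ?_) measureReal_nonneg
  filter_upwards [hfI, self_mem_nhdsWithin] with h hh h0
  refine (measureReal_mono fun ω hω => ?_).trans hh.2.2
  have hω' : e ω = 0 := hω
  have h0' : (0 : ℝ) < h := h0
  exact ⟨by rw [hω']; linarith, hω'.le⟩

open Classical in
/-- The centred median indicator `1/2 - 𝕀(ε ≤ 0)`. -/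
noncomputable def medianScore (ε : ℝ) : ℝ := (1 / 2 : ℝ) - if ε ≤ 0 then 1 else 0

lemma measurable_medianScore : Measurable medianScore :=
  measurable_const.sub (Measurable.ite measurableSet_Iic measurable_const measurable_const)

lemma abs_medianScore (ε : ℝ) : |medianScore ε| = 1 / 2 := by
  unfold medianScore
  split_ifs
  · rw [abs_of_neg] <;> norm_num
  · rw [abs_of_pos] <;> norm_num

lemma integral_medianScore [IsProbabilityMeasure P] {e : Ω → ℝ} (he : Measurable e)
    (hmed : 1 / 2 ≤ P.real {ω | e ω ≤ 0} ∧ 1 / 2 ≤ P.real {ω | 0 ≤ e ω})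
    (h0 : P.real {ω | e ω = 0} = 0) : ∫ ω, medianScore (e ω) ∂P = 0 := by
  have hm : MeasurableSet {ω | e ω ≤ 0} := measurableSet_le he measurable_const
  have h1 : (fun ω => medianScore (e ω)) =
      fun ω => (1 / 2 : ℝ) - {ω | e ω ≤ 0}.indicator (fun _ => (1 : ℝ)) ω := by
    ext ω; simp [medianScore, Set.indicator_apply]
  have h2 : P.real {ω | e ω ≤ 0} = 1 / 2 := by
    refine le_antisymm ?_ hmed.1
    have h3 : P.real {ω | e ω < 0} ≤ 1 / 2 := by
      have : {ω | e ω < 0} = {ω | 0 ≤ e ω}ᶜ := by ext; simp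
      rw [this, probReal_compl_eq_one_sub (measurableSet_le measurable_const he)]
      linarith [hmed.2]
    have h4 : {ω | e ω ≤ 0} ⊆ {ω | e ω < 0} ∪ {ω | e ω = 0} := fun ω hω =>
      (lt_or_eq_of_le (show e ω ≤ 0 from hω))
    linarith [(measureReal_mono (μ := P) h4).trans (measureReal_union_le _ _)]
  rw [h1, integral_sub (integrable_const _) ((integrable_const 1).indicator hm),
    integral_indicator_const _ hm, h2]
  simp

/-- Positive definiteness of the second moment matrix excludes that a component of the moment
function vanishes almost surely. -/
lemma measureReal_inner_ne_zero_pos [IsProbabilityMeasure P] {κ : Type*} [Fintype κ]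
    {b : Ω → EuclideanSpace ℝ κ} {e : Ω → ℝ} (hb : Measurable b) (he : Measurable e)
    (h0 : P.real {ω | e ω = 0} = 0) (hb2 : Integrable (fun ω => ‖b ω‖ ^ 2) P)
    (hpd : (Matrix.of fun i j : κ => ∫ ω, (medianScore (e ω) • b ω) i *
      (medianScore (e ω) • b ω) j ∂P).PosDef) {u : EuclideanSpace ℝ κ} (hu : u ≠ 0) :
    0 < P.real {ω | inner ℝ u (Real.sign (e ω) • b ω) ≠ 0} := by
  refine lt_of_le_of_ne measureReal_nonneg fun hz => ?_
  have hz' : ∀ᵐ ω ∂P, inner ℝ u (Real.sign (e ω) • b ω) = 0 := by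
    rw [ae_iff]; exact (measureReal_eq_zero_iff).1 hz.symm
  have he0 : ∀ᵐ ω ∂P, e ω ≠ 0 := by
    rw [ae_iff]; simpa using (measureReal_eq_zero_iff).1 h0
  have hub : ∀ᵐ ω ∂P, inner ℝ u (b ω) = 0 := by
    filter_upwards [hz', he0] with ω h1 h2
    rw [inner_smul_right, mul_eq_zero] at h1
    exact h1.resolve_left fun h3 => h2 (Real.sign_eq_zero_iff.1 h3)
  have hu' : (fun i => u i) ≠ 0 := fun h => hu (by ext i; exact congrFun h i)
  have hpos := hpd.dotProduct_mulVec_pos hu'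
  set g : Ω → EuclideanSpace ℝ κ := fun ω => medianScore (e ω) • b ω with hg
  have hgm : ∀ i, Measurable fun ω => g ω i := fun i =>
    (by fun_prop : Continuous fun z : EuclideanSpace ℝ κ => z i).measurable.comp
      ((measurable_medianScore.comp he).smul hb)
  have hcoord : ∀ (z : EuclideanSpace ℝ κ) i, |z i| ≤ ‖z‖ := fun z i => PiLp.norm_apply_le z i
  have hgle : ∀ ω i, |g ω i| ≤ ‖b ω‖ := fun ω i => by
    refine (hcoord (g ω) i).trans ?_
    rw [hg]; simp only
    rw [norm_smul, Real.norm_eq_abs, abs_medianScore]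
    linarith [norm_nonneg (b ω)]
  have hint : ∀ i j, Integrable (fun ω => g ω i * g ω j) P := fun i j => by
    refine hb2.mono ((hgm i).mul (hgm j)).aestronglyMeasurable (ae_of_all _ fun ω => ?_)
    rw [norm_mul, Real.norm_of_nonneg (sq_nonneg _), sq]
    exact mul_le_mul (hgle ω i) (hgle ω j) (abs_nonneg _) (norm_nonneg _)
  have hquad : star (fun i => u i) ⬝ᵥ (Matrix.of fun i j : κ => ∫ ω, g ω i * g ω j ∂P).mulVec
      (fun i => u i) = ∫ ω, inner ℝ u (g ω) ^ 2 ∂P := by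
    have h1 : ∀ ω, inner ℝ u (g ω) ^ 2 = ∑ i, ∑ j, u i * u j * (g ω i * g ω j) := fun ω => by
      rw [PiLp.inner_apply, sq, Finset.sum_mul_sum]
      refine Finset.sum_congr rfl fun i _ => Finset.sum_congr rfl fun j _ => ?_
      simp only [RCLike.inner_apply, conj_trivial]; ring
    simp only [h1]
    rw [integral_finsetSum _ fun i _ => integrable_finsetSum _ fun j _ => (hint i j).const_mul _]
    rw [Finset.sum_congr rfl fun i _ => integral_finsetSum _ fun j _ => (hint i j).const_mul _]
    simp only [integral_const_mul, dotProduct, Matrix.mulVec, Matrix.of_apply, star_trivial,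
      Finset.mul_sum]
    exact Finset.sum_congr rfl fun i _ => Finset.sum_congr rfl fun j _ => by ring
  rw [hquad] at hpos
  have hzero : ∫ ω, inner ℝ u (g ω) ^ 2 ∂P = 0 := by
    refine integral_eq_zero_of_ae ?_
    filter_upwards [hub] with ω hω
    rw [hg]; simp [inner_smul_right, hω]
  exact hpos.ne' hzero

/-! ### Root-`n` consistency -/

section MomentFunction

variable {p q : ℕ} (w : EuclideanSpace ℝ (Fin p) → ℝ)
  (φ : EuclideanSpace ℝ (Fin p) → EuclideanSpace ℝ (Fin q))

lemma gFun_eq_medianScore_smul {y : ℤ → ℝ} {t : ℤ} {ε : ℝ} {β : EuclideanSpace ℝ (Fin p)}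
    (h : y t = inner ℝ (lagVec p y (t - 1)) β + ε) :
    gFun w φ y t β = medianScore ε • aStar w φ (lagVec p y (t - 1)) := by
  rw [gFun, medianScore, h, add_sub_cancel_left]

lemma exists_gFun_eq_medianScore_smul (y : ℤ → ℝ) (t : ℤ) (β : EuclideanSpace ℝ (Fin p)) :
    ∃ ε, gFun w φ y t β = medianScore ε • aStar w φ (lagVec p y (t - 1)) :=
  ⟨y t - inner ℝ (lagVec p y (t - 1)) β, gFun_eq_medianScore_smul w φ (by ring)⟩

lemma norm_gFun (y : ℤ → ℝ) (t : ℤ) (β : EuclideanSpace ℝ (Fin p)) :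
    ‖gFun w φ y t β‖ = 1 / 2 * ‖aStar w φ (lagVec p y (t - 1))‖ := by
  obtain ⟨ε, hε⟩ := exists_gFun_eq_medianScore_smul w φ y t β
  rw [hε, norm_smul, Real.norm_eq_abs, abs_medianScore]

lemma inner_gFun_sq (y : ℤ → ℝ) (t : ℤ) (β : EuclideanSpace ℝ (Fin p))
    (u : EuclideanSpace ℝ (Fin p ⊕ Fin q)) :
    inner ℝ u (gFun w φ y t β) ^ 2 = 1 / 4 * inner ℝ u (aStar w φ (lagVec p y (t - 1))) ^ 2 := by
  obtain ⟨ε, hε⟩ := exists_gFun_eq_medianScore_smul w φ y t β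
  rw [hε, inner_smul_right, mul_pow, ← sq_abs (medianScore ε), abs_medianScore]
  norm_num

lemma inner_gFun_add_smul {y : ℤ → ℝ} {t : ℤ} {ε : ℝ} {β : EuclideanSpace ℝ (Fin p)}
    (h : y t = inner ℝ (lagVec p y (t - 1)) β + ε) (u : EuclideanSpace ℝ (Fin p)) (r : ℝ)
    (z : EuclideanSpace ℝ (Fin p ⊕ Fin q)) :
    inner ℝ z (gFun w φ y t (β + r • u)) = inner ℝ z (gFun w φ y t β) -
      stepGain (inner ℝ z (aStar w φ (lagVec p y (t - 1))))
        (r * inner ℝ u (lagVec p y (t - 1))) ε := by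
  have h1 : gFun w φ y t (β + r • u) = ((1 / 2 : ℝ) -
      if ε ≤ r * inner ℝ u (lagVec p y (t - 1)) then 1 else 0) •
        aStar w φ (lagVec p y (t - 1)) := by
    have h2 : y t - inner ℝ (lagVec p y (t - 1)) (β + r • u) ≤ 0 ↔
        ε ≤ r * inner ℝ u (lagVec p y (t - 1)) := by
      rw [h, inner_add_right, inner_smul_right, real_inner_comm u]
      constructor <;> intro h3 <;> linarith
    rw [gFun]
    simp only [h2]
  rw [h1, gFun_eq_medianScore_smul w φ h, inner_smul_right, inner_smul_right, stepGain,
    medianScore]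
  ring

end MomentFunction

end ARChange

open ARChange in
theorem theorem3p1 {Ω : Type*} [MeasurableSpace Ω] (P : Measure Ω) [IsProbabilityMeasure P]
    (p q : ℕ)
    -- parameter space, true parameter, weight function and additional moment functions
    (B : Set (EuclideanSpace ℝ (Fin p))) (β₀ : EuclideanSpace ℝ (Fin p))
    (w : EuclideanSpace ℝ (Fin p) → ℝ) (hw : Measurable w) (hwpos : ∀ x, 0 < w x)
    (φ : EuclideanSpace ℝ (Fin p) → EuclideanSpace ℝ (Fin q)) (hφ : Measurable φ)
    -- i.i.d. innovations and the stationary AR(p) process without change point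
    (e y : ℤ → Ω → ℝ) (he : ∀ t, Measurable (e t)) (hy : ∀ t, Measurable (y t))
    (hindep : iIndepFun e P) (hident : ∀ s t, IdentDistrib (e s) (e t) P P)
    (hstat : ARChange.IsStrictlyStationary P y)
    (hAR : ∀ (t : ℤ) (ω : Ω),
      y t ω = inner ℝ (ARChange.lagVec p (fun s => y s ω) (t - 1)) β₀ + e t ω)
    -- Assumption 1
    (hBcompact : IsCompact B) (hβ₀ : β₀ ∈ interior B)
    (hroots : ∀ β ∈ B, ∀ z : ℂ, ‖z‖ ≤ 1 →
      1 - ∑ i : Fin p, ((β i : ℝ) : ℂ) * z ^ ((i : ℕ) + 1) ≠ 0)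
    (hmedian : ∀ t, 1 / 2 ≤ P.real {ω | e t ω ≤ 0} ∧ 1 / 2 ≤ P.real {ω | 0 ≤ e t ω})
    (hF : ∀ t, DifferentiableAt ℝ (cdf (P.map (e t))) 0 ∧ 0 < deriv (cdf (P.map (e t))) 0)
    -- Assumption 2
    (hmoment : ∀ t : ℤ, Integrable (fun ω =>
      (w (ARChange.lagVec p (fun s => y s ω) (t - 1)) +
          w (ARChange.lagVec p (fun s => y s ω) (t - 1)) ^ 2) *
        (‖ARChange.aFun φ (ARChange.lagVec p (fun s => y s ω) (t - 1))‖ ^ 2 +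
          ‖ARChange.aFun φ (ARChange.lagVec p (fun s => y s ω) (t - 1))‖ ^ 3)) P)
    -- Assumption 3
    (hposDef : ∀ t : ℤ, (Matrix.of fun i j : Fin p ⊕ Fin q =>
      ∫ ω, ARChange.gFun w φ (fun s => y s ω) t β₀ i *
        ARChange.gFun w φ (fun s => y s ω) t β₀ j ∂P).PosDef)
    -- Assumption 4
    (γ : ℝ) (hγ : 2 < γ)
    (hγmoment : ∀ t : ℤ, Integrable (fun ω =>
      ‖ARChange.aStar w φ (ARChange.lagVec p (fun s => y s ω) (t - 1))‖ ^ γ) P)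
    (hmixing : ARChange.IsStrongMixing P (fun (t : ℤ) ω =>
      Real.sign (e t ω) • ARChange.aStar w φ (ARChange.lagVec p (fun s => y s ω) (t - 1))))
    (hmixrate : Summable fun l : ℕ =>
      ARChange.alphaMixing P (fun (t : ℤ) ω =>
        Real.sign (e t ω) • ARChange.aStar w φ (ARChange.lagVec p (fun s => y s ω) (t - 1)))
        (l + 1) ^ (1 - 2 / γ))
    -- the maximum empirical likelihood estimator with `k* = ⌊r n⌋`
    (r : ℝ) (hr : r ∈ Set.Ioo (0 : ℝ) 1)
    (βhat : ℕ → Ω → EuclideanSpace ℝ (Fin p))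
    (hβhat : ∀ n : ℕ, ∀ᵐ ω ∂P, ARChange.IsMaxEL B
      (fun (i : ℕ) β => ARChange.gFun w φ (fun s => y s ω) (i : ℤ) β)
      n ⌊r * (n : ℝ)⌋₊ (βhat n ω)) :
    ARChange.IsBigOInProb P (fun n ω => βhat n ω - β₀)
      (fun n => (n : ℝ) ^ (-(1 / 2) : ℝ)) := by
  rcases Nat.eq_zero_or_pos p with hp0 | hp0
  · -- without parameters there is nothing to estimate
    subst hp0
    intro ε hε
    refine ⟨1, one_pos, Eventually.of_forall fun n => ?_⟩
    have : {ω | 1 * (n : ℝ) ^ (-(1 / 2) : ℝ) < ‖βhat n ω - β₀‖} = ∅ := by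
      ext ω
      simp only [Subsingleton.elim (βhat n ω) β₀, sub_self, norm_zero, one_mul,
        Set.mem_ofPred_eq, Set.mem_empty_iff_false, iff_false, not_lt]
      positivity
    rw [this, measure_empty]
    exact zero_le
  have : NeZero p := ⟨hp0.ne'⟩
  have hβ₀B : β₀ ∈ B := interior_subset hβ₀
  set a := aStar w φ
  have ham : Measurable a := measurable_aStar hw hφ
  let X : ℕ → Ω → EuclideanSpace ℝ (Fin p) := fun i ω => lagVec p (fun s => y s ω) ((i : ℤ) - 1)
  let E : ℕ → Ω → ℝ := fun i => e i
  have hreg : IsCausalRegression P X E :=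
    isCausalRegression_lagVec (hroots β₀ hβ₀B) he hy hindep hident hstat hAR
  have hLLN : SatisfiesCountLLN P fun i ω => Real.sign (E i ω) • a (X i ω) :=
    satisfiesCountLLN_sign_smul hy hstat hAR ham hmixing
  have hfib : P.real {ω | E 0 ω = 0} = 0 := measureReal_zero_fiber (he _) (hF _).1 (hF _).2
  have hmed : ∫ ω, medianScore (E 0 ω) ∂P = 0 := integral_medianScore (he _) (hmedian _) hfib
  have haγ : Integrable (fun ω => ‖a (X 0 ω)‖ ^ γ) P := hγmoment 0
  have ha2 : Integrable (fun ω => ‖a (X 0 ω)‖ ^ 2) P := by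
    have haX : AEStronglyMeasurable (fun ω => a (X 0 ω)) P :=
      (ham.comp (hreg.measurable_regressor 0)).aestronglyMeasurable
    refine Integrable.mono ((integrable_const (1 : ℝ)).add haγ)
      (haX.norm.pow 2) (ae_of_all _ fun ω => ?_)
    have h0 := norm_nonneg (a (X 0 ω))
    have h1 : 0 ≤ ‖a (X 0 ω)‖ ^ γ := Real.rpow_nonneg h0 γ
    rw [Real.norm_of_nonneg (sq_nonneg _), Pi.add_apply, Real.norm_of_nonneg (by linarith)]
    rcases le_total ‖a (X 0 ω)‖ 1 with h2 | h2
    · linarith [pow_le_one₀ h0 h2 (n := 2)]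
    · have h3 := Real.rpow_le_rpow_of_exponent_le h2 hγ.le
      rw [Real.rpow_two] at h3
      linarith
  have hg0 : ∀ (i : ℕ) ω, gFun w φ (fun s => y s ω) i β₀ = medianScore (E i ω) • a (X i ω) :=
    fun i ω => gFun_eq_medianScore_smul w φ (hAR i ω)
  have hnd : ∀ u : EuclideanSpace ℝ (Fin p ⊕ Fin q), u ≠ 0 →
      0 < P.real {ω | inner ℝ u (Real.sign (E 0 ω) • a (X 0 ω)) ≠ 0} := fun u hu => by
    refine measureReal_inner_ne_zero_pos (ham.comp (hreg.measurable_regressor 0)) (he _) hfib ha2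
      ?_ hu
    have hpd := hposDef ((0 : ℕ) : ℤ)
    simp only [hg0] at hpd
    exact hpd
  obtain ⟨c, hc, hquad⟩ := exists_quadratic_lower_bound hLLN hnd
  -- both segments contain a fixed proportion of the observations
  set k : ℕ → ℕ := fun n => ⌊r * (n : ℝ)⌋₊ with hkdef
  obtain ⟨ρ, hρ, hρr, hρr'⟩ : ∃ ρ : ℝ, 0 < ρ ∧ ρ < r ∧ ρ ≤ 1 - r :=
    ⟨min (r / 2) (1 - r), lt_min (half_pos hr.1) (sub_pos.2 hr.2),
      (min_le_left _ _).trans_lt (half_lt_self hr.1), min_le_right _ _⟩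
  have hk1 : ∀ᶠ n : ℕ in atTop, ρ * (n : ℝ) ≤ k n := by
    filter_upwards [(tendsto_natCast_atTop_atTop (R := ℝ)).eventually_ge_atTop (1 / (r - ρ))]
      with n hn
    rw [div_le_iff₀ (sub_pos.2 hρr)] at hn
    have := (Nat.lt_floor_add_one (r * (n : ℝ))).le
    simp only [hkdef]
    linarith
  have hkle : ∀ n : ℕ, (k n : ℝ) ≤ r * n := fun n =>
    Nat.floor_le (mul_nonneg hr.1.le (Nat.cast_nonneg n))
  have hkn : ∀ n, k n ≤ n := fun n => by
    have h1 := hkle n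
    have h2 : r * (n : ℝ) ≤ n := mul_le_of_le_one_left (Nat.cast_nonneg n) hr.2.le
    exact_mod_cast h1.trans h2
  have hk2 : ∀ n : ℕ, ρ * (n : ℝ) ≤ (n : ℝ) - k n := fun n => by
    have h1 := hkle n
    have h2 := mul_le_mul_of_nonneg_right hρr' (Nat.cast_nonneg (α := ℝ) n)
    linarith
  have hρn : Tendsto (fun n : ℕ => ρ * (n : ℝ)) atTop atTop :=
    tendsto_natCast_atTop_atTop.const_mul_atTop hρ
  have hkt : Tendsto k atTop atTop :=
    tendsto_natCast_atTop_iff.1 (tendsto_atTop_mono' _ hk1 hρn :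
      Tendsto (fun n => (k n : ℝ)) atTop atTop)
  have hkt' : Tendsto (fun n => n - k n) atTop atTop := by
    refine tendsto_natCast_atTop_iff.1 (tendsto_atTop_mono (fun n => ?_) hρn :
      Tendsto (fun n => ((n - k n : ℕ) : ℝ)) atTop atTop)
    rw [Nat.cast_sub (hkn n)]
    exact hk2 n
  have hQ1 := hquad (fun _ => 0) k hkt
  have hQ2 := hquad k (fun n => n - k n) hkt'
  intro ε hε
  have hε8 : 0 < ε / 8 := by positivity
  set m := ∫ ω, ‖a (X 0 ω)‖ ^ 2 ∂P
  have hm0 : 0 ≤ m := integral_nonneg fun ω => sq_nonneg _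
  -- seven exceptional events of probability at most `ε / 8`, and the null set on which the
  -- estimator is not a maximizer
  obtain ⟨K, hK, hKm⟩ : ∃ K > 0, m / K ^ 2 ≤ ε / 8 := by
    refine ⟨√(m / (ε / 8)) + 1, by positivity, ?_⟩
    rw [div_le_comm₀ (by positivity) hε8]
    nlinarith [Real.sq_sqrt (by positivity : 0 ≤ m / (ε / 8)), Real.sqrt_nonneg (m / (ε / 8))]
  obtain ⟨κ, hκ, hgain⟩ := exists_sum_stepGain_lower_bound hreg (firstBlock p q) ham hw hwpos
    (inner_firstBlock_aStar w φ) hLLN hnd (hF _).1 (hF _).2 hρ hk1 hε8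
  -- `C` is chosen last, to beat the log likelihood ratio at `β₀`, the quadratic term and the noise
  obtain ⟨C, hC, hCκ⟩ : ∃ C > 0, 4 * K ^ 2 / (c / 8 * ρ) + K ^ 2 + K < κ * C := by
    refine ⟨(4 * K ^ 2 / (c / 8 * ρ) + K ^ 2 + K + 1) / κ, by positivity, ?_⟩
    rw [mul_div_cancel₀ _ hκ.ne']
    linarith
  -- `δ` bounds the maximal moment function relative to `√n`
  obtain ⟨δ, hδ, hδ1, hδ2⟩ : ∃ δ : ℝ, 0 < δ ∧ δ ≤ 1 / 5 ∧ 10 * (K * δ) ≤ c / 8 * ρ := by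
    refine ⟨min (1 / 5) (c / 8 * ρ / (10 * K)), by positivity, min_le_left _ _, ?_⟩
    calc 10 * (K * min (1 / 5) (c / 8 * ρ / (10 * K)))
        ≤ 10 * (K * (c / 8 * ρ / (10 * K))) := by gcongr; exact min_le_right _ _
      _ = c / 8 * ρ := by field_simp
  have hmax := hreg.tendsto_measureReal_exists_gt (f := fun x => ‖a x‖) ham.norm
    (fun x => norm_nonneg _) hγ haγ hδ
  refine ⟨C, hC, ?_⟩
  filter_upwards [hQ1.eventually_le_const hε8, hQ2.eventually_le_const hε8,
    hmax.eventually_le_const hε8, hgain C hC, hk1, hρn.eventually_gt_atTop 0,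
    (tendsto_natCast_atTop_atTop (R := ℝ)).eventually_ge_atTop (K ^ 2 / (c / 8 * ρ ^ 2))]
    with n hB1 hB2 hB5 hB7 hkρ hρn0 hnK
  have hnR : (0 : ℝ) < n := pos_of_mul_pos_right hρn0 hρ.le
  have hs : 0 < √(n : ℝ) := Real.sqrt_pos.2 hnR
  have hss : √(n : ℝ) ^ 2 = n := Real.sq_sqrt hnR.le
  have hkpos : 0 < k n := by
    have : (0 : ℝ) < k n := hρn0.trans_le hkρ
    exact_mod_cast this
  have hkltn : k n < n := by
    have : (k n : ℝ) < n := by linarith [hk2 n]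
    exact_mod_cast this
  have hcard : ∀ I : Finset ℕ, I ⊆ Finset.Icc 1 n → I.card ≤ n := fun I hI => by
    simpa using Finset.card_le_card hI
  have hI1 : Finset.Icc 1 (k n) ⊆ Finset.Icc 1 n := Finset.Icc_subset_Icc le_rfl (hkn n)
  have hI2 : Finset.Icc (k n + 1) n ⊆ Finset.Icc 1 n := Finset.Icc_subset_Icc (by omega) le_rfl
  have hbound : ∀ I : Finset ℕ, I ⊆ Finset.Icc 1 n →
      I.card * m / (K * √(n : ℝ)) ^ 2 ≤ ε / 8 := fun I hI => by
    refine le_trans ?_ hKm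
    rw [mul_pow, hss, div_le_div_iff₀ (by positivity) (by positivity)]
    calc I.card * m * K ^ 2 ≤ n * m * K ^ 2 := by gcongr; exact hcard I hI
      _ = m * (K ^ 2 * n) := by ring
  have hSum : ∀ I : Finset ℕ, I ⊆ Finset.Icc 1 n →
      P.real {ω | K * √(n : ℝ) ≤ ‖∑ i ∈ I, medianScore (E i ω) • a (X i ω)‖} ≤ ε / 8 :=
    fun I hI => (hreg.measureReal_norm_sum_ge_le ham measurable_medianScore
      (fun x => by rw [abs_medianScore]; norm_num) ha2 hmed I (by positivity)).trans (hbound I hI)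
  have hB6 : P.real {ω | (K * √(n : ℝ)) ^ 2 ≤ ∑ i ∈ Finset.Icc 1 (k n), ‖a (X i ω)‖ ^ 2} ≤ ε / 8 :=
    (hreg.measureReal_sum_ge_le (f := fun x => ‖a x‖ ^ 2) (ham.norm.pow_const 2)
      (fun x => sq_nonneg _) ha2 _ (by positivity)).trans (hbound _ hI1)
  have hnull : P.real {ω | ¬ IsMaxEL B
      (fun (i : ℕ) β => gFun w φ (fun s => y s ω) (i : ℤ) β) n (k n) (βhat n ω)} = 0 :=
    (measureReal_eq_zero_iff).2 (ae_iff.1 (hβhat n))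
  simp only [zero_add] at hB1
  rw [show k n + (n - k n) = n from Nat.add_sub_cancel' (hkn n), Nat.cast_sub (hkn n)] at hB2
  have hrpow : (n : ℝ) ^ (-(1 / 2) : ℝ) = (√(n : ℝ))⁻¹ := by
    rw [Real.rpow_neg hnR.le, Real.sqrt_eq_rpow]
  have hsub : {ω | C * (n : ℝ) ^ (-(1 / 2) : ℝ) < ‖βhat n ω - β₀‖} ⊆
      (({ω | ¬ IsMaxEL B (fun (i : ℕ) β => gFun w φ (fun s => y s ω) (i : ℤ) β) n (k n)
          (βhat n ω)} ∪
        {ω | ∃ u, ∑ i ∈ Finset.Icc 1 (k n), inner ℝ u (a (X i ω)) ^ 2 < c * k n * ‖u‖ ^ 2}) ∪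
      ({ω | ∃ u, ∑ i ∈ Finset.Icc (k n + 1) n, inner ℝ u (a (X i ω)) ^ 2 <
          c * ((n : ℝ) - k n) * ‖u‖ ^ 2} ∪
        {ω | K * √(n : ℝ) ≤ ‖∑ i ∈ Finset.Icc 1 (k n), medianScore (E i ω) • a (X i ω)‖})) ∪
      (({ω | K * √(n : ℝ) ≤ ‖∑ i ∈ Finset.Icc (k n + 1) n, medianScore (E i ω) • a (X i ω)‖} ∪
        {ω | ∃ i ∈ Finset.Icc 1 n, δ * √(n : ℝ) < ‖a (X i ω)‖}) ∪
      ({ω | (K * √(n : ℝ)) ^ 2 ≤ ∑ i ∈ Finset.Icc 1 (k n), ‖a (X i ω)‖ ^ 2} ∪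
        {ω | ∃ u ∈ Metric.sphere (0 : EuclideanSpace ℝ (Fin p)) 1, ∃ t ≥ C / √(n : ℝ),
          ∑ i ∈ Finset.Icc 1 (k n), stepGain (inner ℝ (firstBlock p q u) (a (X i ω)))
            (t * inner ℝ u (X i ω)) (E i ω) < κ * C * √(n : ℝ)})) := by
    intro ω hω
    by_contra hcon
    simp only [Set.mem_union, Set.mem_ofPred_eq, not_or, not_le, not_exists, not_lt, not_and,
      not_not] at hcon hω
    obtain ⟨⟨⟨hEL, h1⟩, h2, h3⟩, ⟨h4, h5⟩, h6, h7⟩ := hcon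
    rw [hrpow, ← div_eq_mul_inv] at hω
    have hd0 : 0 < ‖βhat n ω - β₀‖ := lt_of_le_of_lt (by positivity) hω
    set t := ‖βhat n ω - β₀‖
    set u : EuclideanSpace ℝ (Fin p) := t⁻¹ • (βhat n ω - β₀) with hu
    have hu1 : ‖u‖ = 1 := by
      rw [hu, norm_smul, norm_inv, Real.norm_of_nonneg hd0.le, inv_mul_cancel₀ hd0.ne']
    have hβ : βhat n ω = β₀ + t • u := by
      rw [hu, smul_inv_smul₀ hd0.ne', add_sub_cancel]
    have hιu : ‖firstBlock p q u‖ = 1 := by rw [LinearIsometry.norm_map, hu1]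
    refine (hEL.empLik_le (hkn n) hβ₀B).not_gt ?_
    have hnormg : ∀ i ∈ Finset.Icc 1 n, ∀ β,
        ‖gFun w φ (fun s => y s ω) (i : ℤ) β‖ ≤ δ * √(n : ℝ) := fun i hi β => by
      rw [norm_gFun]
      have h8 : ‖aStar w φ (lagVec p (fun s => y s ω) ((i : ℤ) - 1))‖ ≤ δ * √(n : ℝ) := h5 i hi
      linarith [norm_nonneg (aStar w φ (lagVec p (fun s => y s ω) ((i : ℤ) - 1)))]
    -- the multiplier is `-u / √n`
    have hμ : ∀ z : EuclideanSpace ℝ (Fin p ⊕ Fin q),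
        inner ℝ (-(√(n : ℝ))⁻¹ • firstBlock p q u) z =
          -((√(n : ℝ))⁻¹ * inner ℝ (firstBlock p q u) z) := fun z => by
      rw [inner_smul_left, RCLike.conj_to_real, neg_mul]
    refine empLik_lt (fun (i : ℕ) β => gFun w φ (fun s => y s ω) (i : ℤ) β) hkpos hkltn β₀
      (βhat n ω) (c := c / 8) (L := K * √(n : ℝ)) (D := δ * √(n : ℝ)) (N := ρ * n)
      (by positivity) hρn0 hkρ (hk2 n) (fun v => ?_) (fun v => ?_) (fun i hi => hnormg i hi β₀)
      ?_ ?_ ?_ ?_ (-(√(n : ℝ))⁻¹ • firstBlock p q u) (fun i hi => ?_) ?_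
    · simp only [inner_gFun_sq, ← Finset.mul_sum]
      have := h1 v
      simp only [X] at this
      linarith
    · simp only [inner_gFun_sq, ← Finset.mul_sum]
      have := h2 v
      simp only [X] at this
      linarith
    · simp only [hg0]; exact h3.le
    · simp only [hg0]; exact h4.le
    · rw [div_le_iff₀ (by positivity)] at hnK
      rw [mul_pow, hss]
      nlinarith
    · calc 10 * (K * √(n : ℝ) * (δ * √(n : ℝ))) = 10 * (K * δ) * √(n : ℝ) ^ 2 := by ring
        _ ≤ c / 8 * ρ * √(n : ℝ) ^ 2 := by gcongr
        _ = _ := by rw [hss]; ring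
    · rw [hμ, abs_neg, abs_mul, abs_of_pos (inv_pos.2 hs)]
      have h8 := abs_real_inner_le_norm (firstBlock p q u)
        (gFun w φ (fun s => y s ω) (i : ℤ) (βhat n ω))
      rw [hιu, one_mul] at h8
      refine le_trans ?_ hδ1
      rw [inv_mul_le_iff₀ hs]
      linarith [hnormg i (hI1 hi) (βhat n ω)]
    · rw [hμ, inner_sum]
      have hsq : ∑ i ∈ Finset.Icc 1 (k n), inner ℝ (-(√(n : ℝ))⁻¹ • firstBlock p q u)
          (gFun w φ (fun s => y s ω) (i : ℤ) (βhat n ω)) ^ 2 ≤ 1 / 4 * K ^ 2 := by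
        have h8 : ∀ i ∈ Finset.Icc 1 (k n), inner ℝ (-(√(n : ℝ))⁻¹ • firstBlock p q u)
            (gFun w φ (fun s => y s ω) (i : ℤ) (βhat n ω)) ^ 2 ≤
            1 / 4 * (n : ℝ)⁻¹ * ‖a (X i ω)‖ ^ 2 := fun i _ => by
          rw [inner_gFun_sq, hμ, neg_sq, mul_pow, inv_pow, hss, mul_assoc]
          have h9 := abs_real_inner_le_norm (firstBlock p q u) (a (X i ω))
          rw [hιu, one_mul] at h9
          have h10 : inner ℝ (firstBlock p q u) (a (X i ω)) ^ 2 ≤ ‖a (X i ω)‖ ^ 2 := by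
            rw [← sq_abs]; exact pow_le_pow_left₀ (abs_nonneg _) h9 2
          gcongr
        refine (Finset.sum_le_sum h8).trans ?_
        rw [← Finset.mul_sum]
        calc 1 / 4 * (n : ℝ)⁻¹ * ∑ i ∈ Finset.Icc 1 (k n), ‖a (X i ω)‖ ^ 2
            ≤ 1 / 4 * (n : ℝ)⁻¹ * (K * √(n : ℝ)) ^ 2 := by gcongr
          _ = 1 / 4 * K ^ 2 := by rw [mul_pow, hss]; field_simp
      have hmain : κ * C * √(n : ℝ) - K * √(n : ℝ) ≤
          -∑ i ∈ Finset.Icc 1 (k n), inner ℝ (firstBlock p q u)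
            (gFun w φ (fun s => y s ω) (i : ℤ) (βhat n ω)) := by
        have h8 : ∀ i ∈ Finset.Icc 1 (k n), inner ℝ (firstBlock p q u)
            (gFun w φ (fun s => y s ω) (i : ℤ) (βhat n ω)) =
            inner ℝ (firstBlock p q u) (medianScore (E i ω) • a (X i ω)) -
            stepGain (inner ℝ (firstBlock p q u) (a (X i ω))) (t * inner ℝ u (X i ω)) (E i ω) :=
          fun i _ => by
            rw [hβ, inner_gFun_add_smul w φ (hAR i ω), hg0]
        rw [Finset.sum_congr rfl h8, Finset.sum_sub_distrib, ← inner_sum]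
        have h9 := real_inner_le_norm (firstBlock p q u)
          (∑ i ∈ Finset.Icc 1 (k n), medianScore (E i ω) • a (X i ω))
        rw [hιu, one_mul] at h9
        have h10 := h7 u (mem_sphere_zero_iff_norm.2 hu1) t hω.le
        linarith
      have hmain' : κ * C - K ≤ -((√(n : ℝ))⁻¹ * ∑ i ∈ Finset.Icc 1 (k n),
          inner ℝ (firstBlock p q u) (gFun w φ (fun s => y s ω) (i : ℤ) (βhat n ω))) := by
        rw [← mul_neg, le_inv_mul_iff₀ hs]
        linarith
      have hL : 4 * (K * √(n : ℝ)) ^ 2 / (c / 8 * (ρ * n)) = 4 * K ^ 2 / (c / 8 * ρ) := by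
        rw [mul_pow, hss]; field_simp
      rw [hL]
      have := sq_nonneg K
      linarith
  have hfin : P.real {ω | C * (n : ℝ) ^ (-(1 / 2) : ℝ) < ‖βhat n ω - β₀‖} ≤ ε := by
    refine (measureReal_mono hsub).trans ?_
    refine (measureReal_union_le _ _).trans ?_
    refine (add_le_add ((measureReal_union_le _ _).trans
      (add_le_add (measureReal_union_le _ _) (measureReal_union_le _ _)))
      ((measureReal_union_le _ _).trans
      (add_le_add (measureReal_union_le _ _) (measureReal_union_le _ _)))).trans ?_
    linarith [hSum _ hI1, hSum _ hI2]
  rw [← ofReal_measureReal]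
  exact ENNReal.ofReal_le_ofReal hfin
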